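/- A learner faces $m$ tasks over $N$ real features. Task $j$ has a target polynomial $\mathcal G^{(j)}$ in $N$ variables with real coefficients, of degree at most $d$ and with at most $t$ monomials, and at most $S$ training examples ($S\ge 1$) and one further example for verification, drawn i.i.d. from a known product distribution $\mathcal D^{(j)}=\mu^{(j)}_1\times\dots\times\mu^{(j)}_N$ on $\mathbb R^N$ whose marginals are atomless and have finite moments of order $4d$. There is an unknown real $N\times K$ matrix $\mathcal F$ such that the exponent vector of every monomial of every $\mathcal G^{(j)}$ lies in the column space of $\mathcal F$. The first target is not constant. The learner has real arithmetic (with square roots and comparisons), the moments of the $\mu^{(j)}_i$, and a correlation oracle that returns the exact value of $\mathbb E_{x\sim\mathcal D^{(j)}}\big[\prod_i h_i(x_i)\,(P_{\mathcal G^{(j)}}(x)-P_L(x))^p\big]$, $p\in\{1,2\}$, for univariate polynomials $h_i$ and a list $L$ of terms, $P_L$ being the sum of the terms in $L$. An arithmetic operation, comparison or evaluation of a feature costs one step, and an oracle call costs a number of steps proportional to the length of its input. Looking at a cell (example, feature) of the data of a task costs one feature evaluation (once per cell), and an oracle call accounts for evaluating, on all training examples, all features on which $\prod_i h_i$ or $P_L$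 depends. Labels are free of feature evaluations. The protocol keeps a matrix $\tilde{\mathcal F}$ of linearly independent exponent vectors, empty in the beginning. On each task: 1. It computes, for every feature $i$, the polynomials $H^{(i)}_0,\dots,H^{(i)}_{2d}$ orthonormal with respect to $\mu^{(j)}_i$, with positive leading coefficients. It fails if $\tilde{\mathcal F}$ is empty. Otherwise it picks a maximal set $\mathcal I$ of linearly independent rows of $\tilde{\mathcal F}$ and evaluates the features $\mathcal I$ on all training examples. 2. Starting from an empty list $L$ of terms, it does at most $t$ rounds. In a round it finds the lexicographically largest powers $e$ of the features in $\mathcal I$ among the monomials of $P_{\mathcal G^{(j)}}-P_L$, feature by feature, by testing in the order $c=d,d-1,\dots,0$ whether the correlation of $(P_{\mathcal G^{(j)}}-P_L)^2$ with $H^{(i)}_{2c}(x_i)\prod_{i'}H^{(i')}_{2e_{i'}}(x_{i'})$ is positive, where $i'$ runs over the features already treated; if no test is positive, the rounds end. It solves $\tilde{\mathcal F}[\mathcal I]\,w=e$ and sets $\tilde g=\tilde{\mathcal F}w$; it fails if $\tilde g$ is not the exponent vector of a monomial of degree at most $d$. It adds to $L$ the monomial $\tilde g$ with coefficient $\mathbb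 E\big[\prod_i b_iH^{(i)}_{\tilde g_i}(x_i)\,(P_{\mathcal G^{(j)}}-P_L)\big]$, where $b_i$ is the leading coefficient of $H^{(i)}_{\tilde g_i}$. 3. It evaluates on the verification example the features that occur in $L$, and fails if $P_L$ differs from the label there; otherwise it outputs $L$. 4. If any of these steps failed, the target is learned from scratch: all features are evaluated on all training examples, and up to $t$ terms are extracted by the same search over all $N$ features. Then every monomial of the result that is not in the column space of $\tilde{\mathcal F}$ is added, one by one, as a column of $\tilde{\mathcal F}$. Theorem. With probability one the protocol outputs every target exactly (precisely its monomials with their coefficients), learns at most $K$ targets from scratch, makes $O\big(S(KN+m(K+dt))\big)$ feature evaluations in total, with an absolute constant, and takes a number of steps bounded by a fixed polynomial in $m,N,K,S,t,d$. -/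

import Mathlib

open MeasureTheory ProbabilityTheory

namespace LifelongPoly

/-! ### Polynomials as finite collections of terms -/

/-- A term `a · x^g`: an exponent vector `g` and a real coefficient `a`. -/
abbrev Term (N : ℕ) : Type := (Fin N →₀ ℕ) × ℝ

/-- The polynomial represented by a list of terms. -/
noncomputable def toPoly {N : ℕ} (L : List (Term N)) : MvPolynomial (Fin N) ℝ :=
  (L.map fun u => MvPolynomial.monomial u.1 u.2).sum

/-- The list `L` is exactly the set of terms of `G`: no monomial is repeated, and the members of `L`
are the pairs `(g, a)` where `a` is the nonzero coefficient of `x^g` in `G`. -/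
def IsTermList {N : ℕ} (L : List (Term N)) (G : MvPolynomial (Fin N) ℝ) : Prop :=
  (L.map Prod.fst).Nodup ∧
    ∀ (g : Fin N →₀ ℕ) (a : ℝ), (g, a) ∈ L ↔ (a ≠ 0 ∧ MvPolynomial.coeff g G = a)

/-- An exponent vector as a real column vector. -/
def vec {N : ℕ} (g : Fin N →₀ ℕ) : Fin N → ℝ := fun i => (g i : ℝ)

/-- The feature `i` occurs in one of the terms of `L`. -/
def Relevant {N : ℕ} (L : List (Term N)) (i : Fin N) : Prop := ∃ u ∈ L, u.1 i ≠ 0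

/-! ### The machine model

A learner that works on one task is a program over the reals that knows nothing about the task
except through its instructions. The examples of the task are `n` training examples
(rows `Fin.castSucc s`) and one further example for verification (row `Fin.last n`). -/

/-- Instructions that return a real number. -/
inductive Instr (N n : ℕ) : Type
  /-- real arithmetic -/
  | add (a b : ℝ) : Instr N n
  | sub (a b : ℝ) : Instr N n
  | mul (a b : ℝ) : Instr N n
  | div (a b : ℝ) : Instr N n
  | sqrt (a : ℝ) : Instr N n
  /-- knowledge of the distribution: the `k`-th moment of the marginal of feature `i` -/
  | moment (i : Fin N) (k : ℕ) : Instr N n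
  /-- the correlation oracle: the exact value of `⟨∏ i, h i (x i), (P_G - P_L)^p⟩`, where `h i` is the
  univariate polynomial with coefficients `h i 0, h i 1, …`, `G` is the target and `L` the list of
  terms extracted so far -/
  | corr (w : ℕ) (h : Fin N → Fin w → ℝ) (L : List (Term N)) (p : ℕ) : Instr N n
  /-- evaluate the feature `i` on the example `s` -/
  | probe (s : Fin (n + 1)) (i : Fin N) : Instr N n
  /-- read the label of the example `s` -/
  | label (s : Fin (n + 1)) : Instr N n

/-- Programs: sequences of instructions, comparisons `a < b` and bookkeeping steps. -/
inductive Prog (N n : ℕ) (α : Type) : Type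
  | ret (a : α) : Prog N n α
  | ask (q : Instr N n) (k : ℝ → Prog N n α) : Prog N n α
  | cmp (a b : ℝ) (k : Bool → Prog N n α) : Prog N n α
  | tick (c : ℕ) (p : Prog N n α) : Prog N n α

/-- Sequential composition. -/
def Prog.bind {N n : ℕ} {α β : Type} : Prog N n α → (α → Prog N n β) → Prog N n β
  | .ret a, f => f a
  | .ask q k, f => .ask q fun r => (k r).bind f
  | .cmp a b k, f => .cmp a b fun r => (k r).bind f
  | .tick c p, f => .tick c (p.bind f)

instance {N n : ℕ} : Monad (Prog N n) where
  pure := Prog.ret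
  bind := Prog.bind

/-- What a program runs against: the product distribution (through its marginals), the target, and
the examples. -/
structure Env (N n : ℕ) where
  dist : Fin N → Measure ℝ
  target : MvPolynomial (Fin N) ℝ
  data : Fin (n + 1) → Fin N → ℝ

/-- The answers to the instructions. -/
noncomputable def Env.answer {N n : ℕ} (E : Env N n) : Instr N n → ℝ
  | .add a b => a + b
  | .sub a b => a - b
  | .mul a b => a * b
  | .div a b => a / b
  | .sqrt a => Real.sqrt a
  | .moment i k => ∫ y, y ^ k ∂(E.dist i)
  | .corr w h L p =>
      ∫ x, (∏ i, ∑ k : Fin w, h i k * x i ^ (k : ℕ)) *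
        (MvPolynomial.eval x (E.target - toPoly L)) ^ p ∂(Measure.pi E.dist)
  | .probe s i => E.data s i
  | .label s => MvPolynomial.eval (E.data s) E.target

/-- The number of steps that an instruction takes: one, except that a call of the correlation oracle
also pays for the length of its input. -/
def Instr.cost {N n : ℕ} : Instr N n → ℕ
  | .corr w _ L _ => N * w + (N + 1) * L.length + 1
  | _ => 1

open Classical in
/-- The cells of the data matrix that an instruction looks at. A correlation stands for an estimate
on the training examples, so it needs, on every training example, every feature on which the
correlated functions of `x` (the product of the `h i` and `P_L`) depend. -/
noncomputable def Instr.cells {N n : ℕ} : Instr N n → Finset (Fin (n + 1) × Fin N)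
  | .corr w h L _ =>
      (Finset.univ.filter fun s => s ≠ Fin.last n) ×ˢ
        (Finset.univ.filter fun i =>
          (∃ k : Fin w, (k : ℕ) ≠ 0 ∧ h i k ≠ 0) ∨ Relevant L i)
  | .probe s i => {(s, i)}
  | _ => ∅

/-- The result of a run: the value returned, the number of steps, and the set of cells of the data
matrix that were evaluated. -/
structure Outcome (N n : ℕ) (α : Type) where
  value : α
  steps : ℕ
  cells : Finset (Fin (n + 1) × Fin N)

open Classical in
/-- Running a program. -/
noncomputable def Prog.run {N n : ℕ} {α : Type} (E : Env N n) : Prog N n α → Outcome N n α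
  | .ret a => ⟨a, 0, ∅⟩
  | .ask q k =>
      let r := (k (E.answer q)).run E
      ⟨r.value, q.cost + r.steps, q.cells ∪ r.cells⟩
  | .cmp a b k =>
      let r := (k (decide (a < b))).run E
      ⟨r.value, 1 + r.steps, r.cells⟩
  | .tick c p =>
      let r := p.run E
      ⟨r.value, c + r.steps, r.cells⟩

section Programs

variable {N n : ℕ}

/-- A single instruction. -/
def exec (q : Instr N n) : Prog N n ℝ := .ask q .ret

/-- The comparison `a < b`. -/
def less (a b : ℝ) : Prog N n Bool := .cmp a b .ret

/-- `c` bookkeeping steps. -/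
def work (c : ℕ) : Prog N n Unit := .tick c (.ret ())

/-- The comparison `a = b`. -/
def same (a b : ℝ) : Prog N n Bool := do
  let x ← less a b
  let y ← less b a
  pure (!x && !y)

/-- Fill an array of length `k`. -/
def tabulate {β : Type} : (k : ℕ) → (Fin k → Prog N n β) → Prog N n (Fin k → β)
  | 0, _ => pure fun i => i.elim0
  | k + 1, f => do
      let a ← f 0
      let v ← tabulate k fun i => f i.succ
      work 1
      pure (Fin.cons (α := fun _ => β) a v)

/-- Compute a sum of `k` numbers. -/
def sumOver : (k : ℕ) → (Fin k → Prog N n ℝ) → Prog N n ℝ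
  | 0, _ => pure 0
  | k + 1, f => do
      let a ← f 0
      let s ← sumOver k fun i => f i.succ
      exec (.add a s)

/-- Compute a product of `k` numbers. -/
def prodOver : (k : ℕ) → (Fin k → Prog N n ℝ) → Prog N n ℝ
  | 0, _ => pure 1
  | k + 1, f => do
      let a ← f 0
      let s ← prodOver k fun i => f i.succ
      exec (.mul a s)

/-- Compute a power. -/
def power (y : ℝ) : ℕ → Prog N n ℝ
  | 0 => pure 1
  | c + 1 => do
      let p ← power y c
      exec (.mul p y)

/-- Evaluate a list of cells of the data matrix. -/
def probeCells : List (Fin (n + 1) × Fin N) → Prog N n Unit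
  | [] => pure ()
  | c :: L => do
      let _ ← exec (.probe c.1 c.2)
      probeCells L

/-- Evaluate the features in the list `I` on all training examples. -/
def probeTraining (I : List (Fin N)) : Prog N n Unit :=
  probeCells (((List.finRange n).map Fin.castSucc).product I)

/-! #### Linear algebra by orthogonalisation -/

/-- The standard inner product. -/
def dot {k : ℕ} (u v : Fin k → ℝ) : Prog N n ℝ := sumOver k fun i => exec (.mul (u i) (v i))

/-- Subtract from the linear equation `⟨r.1, w⟩ = r.2` multiples of the equations in `Q`, whose left
sides are pairwise orthogonal, so that its left side becomes orthogonal to them. -/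
def reduce {k : ℕ} : List ((Fin k → ℝ) × ℝ) → (Fin k → ℝ) × ℝ → Prog N n ((Fin k → ℝ) × ℝ)
  | [], r => pure r
  | q :: Q, r => do
      let a ← dot r.1 q.1
      let b ← dot q.1 q.1
      let c ← exec (.div a b)
      let v ← tabulate k fun i => do
        let p ← exec (.mul c (q.1 i))
        exec (.sub (r.1 i) p)
      let p ← exec (.mul c q.2)
      let s ← exec (.sub r.2 p)
      reduce Q (v, s)

/-- Orthogonalise a list of equations, leaving out those whose left side is linearly dependent on the
previous ones. -/
def orthogonalize {k : ℕ} (Q : List ((Fin k → ℝ) × ℝ)) :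
    List ((Fin k → ℝ) × ℝ) → Prog N n (List ((Fin k → ℝ) × ℝ))
  | [] => pure Q
  | r :: R => do
      let r' ← reduce Q r
      let z ← dot r'.1 r'.1
      let b ← less 0 z
      if b then orthogonalize (Q ++ [r']) R else orthogonalize Q R

/-- The solution of a linear system of `k` equations with linearly independent left sides in `k`
unknowns. -/
def solve {k : ℕ} (R : List ((Fin k → ℝ) × ℝ)) : Prog N n (Fin k → ℝ) := do
  let Q ← orthogonalize [] R
  tabulate k fun l => sumOver Q.length fun m => do
    let z ← dot (Q.get m).1 (Q.get m).1
    let c ← exec (.div (Q.get m).2 z)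
    exec (.mul c ((Q.get m).1 l))

/-- The learned representation: the list of its columns. -/
abbrev Rep (N : ℕ) : Type := List (Fin N →₀ ℕ)

/-- Row `i` of the matrix with columns `F`. -/
def row (F : Rep N) (i : Fin N) : Fin F.length → ℝ := fun l => ((F.get l) i : ℝ)

/-- Run through the given rows and keep those that are linearly independent of the ones kept
before. -/
def independentRows (F : Rep N) (Q : List ((Fin F.length → ℝ) × ℝ)) :
    List (Fin N) → Prog N n (List (Fin N))
  | [] => pure []
  | i :: L => do
      let r ← reduce Q (row F i, 0)
      let z ← dot r.1 r.1
      let b ← less 0 z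
      if b then do
        let I ← independentRows F (Q ++ [r]) L
        pure (i :: I)
      else independentRows F Q L

/-- Decide whether `g` lies in the column space of `F`. -/
def inColumnSpace (F : Rep N) (g : Fin N →₀ ℕ) : Prog N n Bool := do
  let Q ← orthogonalize [] (F.map fun f => (vec f, (0 : ℝ)))
  let r ← reduce Q (vec g, 0)
  let z ← dot r.1 r.1
  let b ← less 0 z
  pure (!b)

/-! #### The inventory of orthonormal polynomials -/

/-- The inner product `𝔼[u(x) v(x)]` of two univariate polynomials of degree at most `2d`, given by
their coefficients, from the moments `M`. -/
def polyInner {d : ℕ} (M : Fin (4 * d + 1) → ℝ) (u v : Fin (2 * d + 1) → ℝ) : Prog N n ℝ :=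
  sumOver (2 * d + 1) fun a => sumOver (2 * d + 1) fun b => do
    let p ← exec (.mul (u a) (v b))
    exec (.mul p (M ⟨a + b, by omega⟩))

/-- The orthonormal polynomials of degree `0, …, k - 1` (with positive leading coefficients), by the
Gram-Schmidt process. -/
def orthonormalPolys {d : ℕ} (M : Fin (4 * d + 1) → ℝ) :
    (k : ℕ) → Prog N n (Fin k → Fin (2 * d + 1) → ℝ)
  | 0 => pure fun i => i.elim0
  | k + 1 => do
      let H ← orthonormalPolys M k
      let e : Fin (2 * d + 1) → ℝ := fun a => if (a : ℕ) = k then 1 else 0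
      let c ← tabulate k fun l => polyInner M e (H l)
      let v ← tabulate (2 * d + 1) fun a => do
        let s ← sumOver k fun l => exec (.mul (c l) (H l a))
        exec (.sub (e a) s)
      let q ← polyInner M v v
      let r ← exec (.sqrt q)
      let h ← tabulate (2 * d + 1) fun a => exec (.div (v a) r)
      pure (Fin.snoc (α := fun _ => Fin (2 * d + 1) → ℝ) H h)

/-- `H i c a` is the coefficient of `x^a` in the orthonormal polynomial of degree `c` for the marginal
distribution of feature `i`. -/
abbrev Inventory (N d : ℕ) : Type := Fin N → Fin (2 * d + 1) → Fin (2 * d + 1) → ℝ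

/-- Create the inventory. -/
def inventory (d : ℕ) : Prog N n (Inventory N d) :=
  tabulate N fun i => do
    let M ← tabulate (4 * d + 1) fun k => exec (.moment i k)
    orthonormalPolys M (2 * d + 1)

/-! #### Lexicographic search -/

/-- The test `⟨∏ i, H_{2 e_i}(x_i), (P_G - P_L)^2⟩ > 0`. -/
def test {d : ℕ} (H : Inventory N d) (L : List (Term N)) (e : Fin N →₀ ℕ) : Prog N n Bool := do
  let v ← exec (.corr (2 * d + 1) (fun i => H i (Fin.ofNat (2 * d + 1) (2 * e i))) L 2)
  less 0 v

/-- The first of the powers `c, c - 1, …, 0` of feature `i` for which the test is positive, if any. -/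
noncomputable def topPower {d : ℕ} (H : Inventory N d) (L : List (Term N)) (e : Fin N →₀ ℕ)
    (i : Fin N) : ℕ → Prog N n (Option ℕ)
  | 0 => do
      let b ← test H L (e.update i 0)
      pure (if b then some 0 else none)
  | c + 1 => do
      let b ← test H L (e.update i (c + 1))
      if b then pure (some (c + 1)) else topPower H L e i c

/-- Lexicographic search over the features in a list, extending the powers `e` found so far. The
result is `none` if there is no monomial left. -/
noncomputable def lexSearch {d : ℕ} (H : Inventory N d) (L : List (Term N)) :
    List (Fin N) → (Fin N →₀ ℕ) → Prog N n (Option (Fin N →₀ ℕ))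
  | [], e => pure (some e)
  | i :: I, e => do
      let o ← topPower H L e i d
      match o with
      | none => pure none
      | some c => lexSearch H L I (e.update i c)

/-- The coefficient `⟨∏ i, b_{g_i} H_{g_i}(x_i), P_G - P_L⟩`, where `b_{g_i}` is the leading coefficient
of `H_{g_i}`. -/
def coefficient {d : ℕ} (H : Inventory N d) (L : List (Term N)) (g : Fin N →₀ ℕ) :
    Prog N n ℝ := do
  let h ← tabulate N fun i => tabulate (2 * d + 1) fun a =>
    exec (.mul (H i (Fin.ofNat (2 * d + 1) (g i)) (Fin.ofNat (2 * d + 1) (g i)))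
      (H i (Fin.ofNat (2 * d + 1) (g i)) a))
  exec (.corr (2 * d + 1) h L 1)

/-- At most `r` rounds of extraction. A round finds the lexicographically largest powers `e` of the
features in `I`, turns them into a monomial with `lift` (or halts with failure), and adds this
monomial with its coefficient to the terms `L` extracted before. -/
noncomputable def extract {d : ℕ} (H : Inventory N d) (I : List (Fin N))
    (lift : (Fin N →₀ ℕ) → Prog N n (Option (Fin N →₀ ℕ))) :
    ℕ → List (Term N) → Prog N n (Option (List (Term N)))
  | 0, L => pure (some L)
  | r + 1, L => do
      let o ← lexSearch H L I 0
      match o with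
      | none => pure (some L)
      | some e => do
          let o' ← lift e
          match o' with
          | none => pure none
          | some g => do
              let a ← coefficient H L g
              extract H I lift r (L ++ [(g, a)])

/-- Learning a target from scratch: evaluate all features on all training examples, and extract at
most `t` monomials by lexicographic search over all features. -/
noncomputable def learnFromScratch {d : ℕ} (t : ℕ) (H : Inventory N d) :
    Prog N n (List (Term N)) := do
  probeTraining (List.finRange N)
  let o ← extract H (List.finRange N) (fun e => pure (some e)) t []
  pure (o.getD [])

/-! #### Learning from the representation -/

/-- The natural number among `0, …, c` that equals `y`, if any. -/
def asPower (y : ℝ) : ℕ → Prog N n (Option ℕ)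
  | 0 => do
      let b ← same y 0
      pure (if b then some 0 else none)
  | c + 1 => do
      let b ← same y ((c + 1 : ℕ) : ℝ)
      if b then pure (some (c + 1)) else asPower y c

/-- Solve `F[I] w = e[I]` and return `F w`; failure if this is not the exponent vector of a monomial of
degree at most `d`. -/
noncomputable def liftPowers (d : ℕ) (F : Rep N) (I : List (Fin N)) (e : Fin N →₀ ℕ) :
    Prog N n (Option (Fin N →₀ ℕ)) := do
  let w ← solve (I.map fun i => (row F i, (e i : ℝ)))
  let v ← tabulate N fun i => sumOver F.length fun l => exec (.mul (row F i l) (w l))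
  let o ← tabulate N fun i => asPower (v i) d
  work N
  pure (if (∀ i, (o i).isSome) ∧ ∑ i, (o i).getD 0 ≤ d then
    some (Finsupp.equivFunOnFinite.symm fun i => (o i).getD 0) else none)

open Classical in
/-- Verification on a single example: evaluate the features that are relevant to `L` and compare the
value of `P_L` with the label. -/
noncomputable def verify (L : List (Term N)) : Prog N n Bool := do
  work (N * L.length)
  let x ← tabulate N fun i =>
    if Relevant L i then exec (.probe (Fin.last n) i) else pure 0
  let v ← sumOver L.length fun u => do
    let p ← prodOver N fun i => power (x i) ((L.get u).1 i)
    exec (.mul (L.get u).2 p)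
  let y ← exec (.label (Fin.last n))
  same v y

/-- Learning a polynomial with the representation `F`; the result `none` is failure. -/
noncomputable def useRep {d : ℕ} (t : ℕ) (H : Inventory N d) (F : Rep N) :
    Prog N n (Option (List (Term N))) := do
  work 1
  if F.isEmpty then pure none
  else do
    let I ← independentRows F [] (List.finRange N)
    probeTraining I
    let o ← extract H I (liftPowers d F I) t []
    match o with
    | none => pure none
    | some L => do
        let b ← verify L
        pure (if b then some L else none)

/-- Improving the representation: add, one by one, the monomials of a target learned from scratch that
are not in the column space. -/
def improveRep : List (Term N) → Rep N → Prog N n (Rep N)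
  | [], F => pure F
  | u :: L, F => do
      let b ← inColumnSpace F u.1
      improveRep L (if b then F else F ++ [u.1])

/-- What the protocol produces on one task: the polynomial learned, whether it was learned from
scratch, and the representation for the next task. -/
structure TaskResult (N : ℕ) where
  output : List (Term N)
  fromScratch : Bool
  rep : Rep N

/-- The protocol on one task: try to learn with the representation; if this fails, learn from scratch
and improve the representation. -/
noncomputable def taskProgram (d t : ℕ) (F : Rep N) : Prog N n (TaskResult N) := do
  let H ← inventory d
  let o ← useRep t H F
  match o with
  | some L => pure ⟨L, false, F⟩
  | none => do
      let L ← learnFromScratch t H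
      let F' ← improveRep L F
      pure ⟨L, true, F'⟩

end Programs

/-! ### The lifelong protocol -/

/-- A task: the marginals of its product distribution, its target polynomial, and the number of its
training examples. -/
structure Task (N : ℕ) where
  dist : Fin N → Measure ℝ
  target : MvPolynomial (Fin N) ℝ
  size : ℕ

/-- The run of the protocol on one task with examples `x`, starting from the representation `F`. -/
noncomputable def runTask {N : ℕ} (d t : ℕ) (T : Task N) (x : Fin (T.size + 1) → Fin N → ℝ)
    (F : Rep N) : Outcome N T.size (TaskResult N) :=
  (taskProgram d t F).run ⟨T.dist, T.target, x⟩

section Protocol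

variable {N m : ℕ} (d t : ℕ) (task : Fin m → Task N)
  (x : (j : Fin m) → Fin ((task j).size + 1) → Fin N → ℝ)

/-- The representation after the first `j` tasks; it is empty in the beginning. -/
noncomputable def repAfter : ℕ → Rep N
  | 0 => []
  | j + 1 =>
      if h : j < m then (runTask d t (task ⟨j, h⟩) (x ⟨j, h⟩) (repAfter j)).value.rep
      else repAfter j

/-- The run of the protocol on the task `j`. -/
noncomputable def protocol (j : Fin m) : Outcome N (task j).size (TaskResult N) :=
  runTask d t (task j) (x j) (repAfter d t task x j)

/-- The number of tasks that are learned from scratch. -/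
noncomputable def scratchCount : ℕ :=
  (Finset.univ.filter fun j => (protocol d t task x j).value.fromScratch = true).card

/-- The total number of feature evaluations. -/
noncomputable def featureEvaluations : ℕ := ∑ j, (protocol d t task x j).cells.card

/-- The total number of steps. -/
noncomputable def totalSteps : ℕ := ∑ j, (protocol d t task x j).steps

end Protocol

end LifelongPoly

namespace LifelongPoly

/-! ### Semantics of programs -/

section Semantics

variable {N n : ℕ} {α β : Type} (E : Env N n)

/-! Everything rests on a triangularity of the orthonormal polynomials `H_c` of a marginal:
`𝔼[H_c(x) x^j]` is zero for `j < c`, and for `j = c` it is the inverse of the leading coefficient of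
`H_c`. Let `Q = P_G - P_L`, and let `e` be powers on a set `A` of features such that two monomials
of `Q` whose product reaches `2e` on all of `A` must both have exactly the powers `e` there
(`IsTop`). Correlating `Q²` with `∏ H_{2e_i}(x_i)` kills every pair of monomials except the pairs
that agree with `e` on `A`. What remains is a positive constant times the mean square of a
polynomial in the other features. This is positive unless the polynomial is zero, because zero sets
of nonzero polynomials are null sets for atomless products (`ae_mvPolynomial_eval_ne_zero`). So a
test is positive exactly if a matching monomial exists (`test_value`), the search keeps `IsTop`
(`IsTop.insert`), and the coefficient is isolated by the same triangularity (`coefficient_value`).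

The selected rows of a representation have the same kernel as the whole matrix. Hence a monomial in
the column space is determined by its powers on these rows (`runs_liftPowers`), and a target whose
monomials all lie in the column space is extracted completely (`candidate_of_mem_colSpan`). For
other targets the extraction may return a wrong list, but this list is a function of the
distribution, the target and the representation, not of the examples (`candidate_congr_data`). Its
difference from the target is then a fixed nonzero polynomial, whose zeros the verification example
avoids almost surely (`ae_verificationSound`). As there are countably many representations, one null
set serves for all of them.

Outside this null set, a nonempty representation succeeds exactly on the targets that it covers.
Learning from scratch therefore always adds a column (`taskProgram_outcome`). The columns stay
independent and inside the column space of the unknown matrix, so this happens at most `K` times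
(`IsGoodRep.succ`, `IsIndependent.length_le`). Since `H_0 = 1`, a correlation only looks at features
that have a nonzero power or occur in extracted terms, which bounds the feature evaluations
(`runs_extract`, `runs_useRep`). The number of steps is tracked by explicit cost expressions that
make sense in every commutative semiring, hence also as polynomials. -/

theorem run_bind_value (p : Prog N n α) (f : α → Prog N n β) :
    ((p >>= f).run E).value = ((f (p.run E).value).run E).value := by
  change ((p.bind f).run E).value = _
  induction p with
  | ret a => rfl
  | ask q k ih => exact ih _
  | cmp a b k ih => exact ih _
  | tick c p ih => exact ih

theorem run_bind_steps (p : Prog N n α) (f : α → Prog N n β) :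
    ((p >>= f).run E).steps = (p.run E).steps + ((f (p.run E).value).run E).steps := by
  change ((p.bind f).run E).steps = _
  induction p with
  | ret a => simp [Prog.bind, Prog.run]
  | ask q k ih => simp only [Prog.bind, Prog.run, ih]; ring
  | cmp a b k ih => simp only [Prog.bind, Prog.run, ih]; ring
  | tick c p ih => simp only [Prog.bind, Prog.run, ih]; ring

open Classical in
theorem run_bind_cells (p : Prog N n α) (f : α → Prog N n β) :
    ((p >>= f).run E).cells = (p.run E).cells ∪ ((f (p.run E).value).run E).cells := by
  change ((p.bind f).run E).cells = _
  induction p with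
  | ret a => simp [Prog.bind, Prog.run]
  | ask q k ih => simp only [Prog.bind, Prog.run, ih, Finset.union_assoc]
  | cmp a b k ih => simp only [Prog.bind, Prog.run, ih]
  | tick c p ih => simp only [Prog.bind, Prog.run, ih]

theorem run_pure (a : α) : (pure a : Prog N n α).run E = ⟨a, 0, ∅⟩ := rfl

theorem run_exec (q : Instr N n) :
    (exec q).run E = ⟨E.answer q, q.cost, q.cells⟩ := by
  simp [exec, Prog.run]

open Classical in
theorem run_less (a b : ℝ) :
    (less a b : Prog N n Bool).run E = ⟨decide (a < b), 1, ∅⟩ := by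
  simp [less, Prog.run]

theorem run_work (c : ℕ) : (work c : Prog N n Unit).run E = ⟨(), c, ∅⟩ := by
  simp [work, Prog.run]

/-- The run of `p` returns `a` after `c` steps without looking at the data. -/
def Computes (p : Prog N n α) (a : α) (c : ℕ) : Prop := p.run E = ⟨a, c, ∅⟩

/-- The run of `p` returns a value that satisfies `Q` after at most `c` steps, and evaluates only
cells in `A`. -/
structure Runs (p : Prog N n α) (Q : α → Prop) (c : ℕ) (A : Finset (Fin (n + 1) × Fin N)) :
    Prop where
  value : Q (p.run E).value
  steps : (p.run E).steps ≤ c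
  cells : (p.run E).cells ⊆ A

variable {E}

theorem Computes.value {p : Prog N n α} {a : α} {c : ℕ} (h : Computes E p a c) :
    (p.run E).value = a := by rw [h]

theorem Computes.bind {p : Prog N n α} {a : α} {c : ℕ} {f : α → Prog N n β} {b : β} {c' : ℕ}
    (hp : Computes E p a c) (hf : Computes E (f a) b c') : Computes E (p >>= f) b (c + c') := by
  have h1 := run_bind_value E p f
  have h2 := run_bind_steps E p f
  have h3 := run_bind_cells E p f
  unfold Computes at *
  rw [hp] at h1 h2 h3
  simp only [hf] at h1 h2 h3
  cases hr : (p >>= f).run E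
  simp_all

theorem Computes.of_eq {p : Prog N n α} {a a' : α} {c c' : ℕ} (h : Computes E p a c)
    (ha : a = a') (hc : c = c') : Computes E p a' c' := ha ▸ hc ▸ h

theorem Computes.pure (a : α) : Computes E (pure a) a 0 := rfl

theorem Runs.of {p : Prog N n α} {a : α} {c : ℕ} (h : Computes E p a c) {Q : α → Prop}
    (ha : Q a) {c' : ℕ} (hc : c ≤ c') (A) : Runs E p Q c' A := by
  constructor <;> simp_all [Computes]

theorem Runs.of_eq {p : Prog N n α} {a : α} {c : ℕ} (h : Computes E p a c) (A) :
    Runs E p (fun b => b = a) c A :=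
  ⟨h.value, by rw [show p.run E = _ from h], by rw [show p.run E = _ from h]; simp⟩

theorem Runs.pure_eq (a : α) (c : ℕ) (A) :
    Runs E (Pure.pure a : Prog N n α) (fun b => b = a) c A := ⟨rfl, Nat.zero_le _, by simp [run_pure]⟩

theorem Runs.bind {p : Prog N n α} {Q : α → Prop} {c : ℕ} {A} {f : α → Prog N n β}
    {R : β → Prop} {c' : ℕ} (hp : Runs E p Q c A) (hf : ∀ a, Q a → Runs E (f a) R c' A) :
    Runs E (p >>= f) R (c + c') A := by
  have hf' := hf _ hp.value
  refine ⟨?_, ?_, ?_⟩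
  · rw [run_bind_value]; exact hf'.value
  · rw [run_bind_steps]; exact add_le_add hp.steps hf'.steps
  · rw [run_bind_cells]; exact Finset.union_subset hp.cells hf'.cells

theorem Runs.mono {p : Prog N n α} {Q Q' : α → Prop} {c c' : ℕ} {A A'} (h : Runs E p Q c A)
    (hQ : ∀ a, Q a → Q' a) (hc : c ≤ c') (hA : A ⊆ A') : Runs E p Q' c' A' :=
  ⟨hQ _ h.value, h.steps.trans hc, h.cells.trans hA⟩

theorem Runs.pure {a : α} {Q : α → Prop} (h : Q a) (c : ℕ) (A) : Runs E (pure a) Q c A :=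
  .of (.pure a) h (Nat.zero_le _) A

theorem Runs.exec {q : Instr N n} {A} (hA : q.cells ⊆ A) :
    Runs E (exec q) (fun _ => True) q.cost A := by
  rw [← show ((LifelongPoly.exec q).run E).cells = q.cells by rw [run_exec]] at hA
  exact ⟨trivial, by rw [run_exec], hA⟩

/-- The continuation is examined only at the value actually returned. Bounds on evaluated cells need
this when the set of cells depends on the course of the run. -/
theorem Runs.bind_value {p : Prog N n α} {Q : α → Prop} {c : ℕ} {A} {f : α → Prog N n β}
    {R : β → Prop} {c' : ℕ} (hp : Runs E p Q c A) (hf : Runs E (f (p.run E).value) R c' A) :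
    Runs E (p >>= f) R (c + c') A :=
  Runs.bind (Q := fun a => a = (p.run E).value) ⟨rfl, hp.steps, hp.cells⟩ fun _ h => h ▸ hf

theorem Runs.bind_of {p : Prog N n α} {a : α} {c : ℕ} {A} {f : α → Prog N n β}
    {R : β → Prop} {c' : ℕ} (hp : Computes E p a c) (hf : Runs E (f a) R c' A) :
    Runs E (p >>= f) R (c + c') A :=
  Runs.bind (Runs.of_eq hp _) fun _ h => h ▸ hf

/-- A program is blind if its value does not depend on the data. -/
def Blind (p : Prog N n α) : Prop :=
  ∀ (μ : Fin N → Measure ℝ) (G : MvPolynomial (Fin N) ℝ) (x y : Fin (n + 1) → Fin N → ℝ),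
    (p.run ⟨μ, G, x⟩).value = (p.run ⟨μ, G, y⟩).value

theorem Blind.bind {p : Prog N n α} {f : α → Prog N n β} (hp : Blind p)
    (hf : ∀ a, Blind (f a)) : Blind (p >>= f) := fun μ G x y => by
  rw [run_bind_value, run_bind_value, hp μ G x y, hf _ μ G x y]

theorem Blind.pure (a : α) : Blind (pure a : Prog N n α) := fun _ _ _ _ => rfl

/-- There is only one possible value, so this covers even programs that read cells. -/
theorem Blind.unit (p : Prog N n Unit) : Blind p := fun _ _ _ _ => rfl

theorem Blind.less (a b : ℝ) : Blind (less a b : Prog N n Bool) := fun _ _ _ _ => by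
  simp [run_less]

theorem Computes.add (a b : ℝ) : Computes E (exec (.add a b)) (a + b) 1 := run_exec E _
theorem Computes.sub (a b : ℝ) : Computes E (exec (.sub a b)) (a - b) 1 := run_exec E _
theorem Computes.mul (a b : ℝ) : Computes E (exec (.mul a b)) (a * b) 1 := run_exec E _
theorem Computes.div (a b : ℝ) : Computes E (exec (.div a b)) (a / b) 1 := run_exec E _
theorem Computes.sqrt (a : ℝ) : Computes E (exec (.sqrt a)) (√a) 1 := run_exec E _
theorem Computes.moment (i : Fin N) (k : ℕ) :
    Computes E (exec (.moment i k)) (∫ y, y ^ k ∂(E.dist i)) 1 := run_exec E _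

open Classical in
theorem Computes.less (a b : ℝ) : Computes E (less a b) (decide (a < b)) 1 := run_less E _ _

theorem Computes.work (c : ℕ) : Computes E (work c) () c := run_work E c

open Classical in
theorem Computes.same (a b : ℝ) : Computes E (same a b) (decide (a = b)) 2 := by
  refine Computes.of_eq (.bind (.less a b) (.bind (.less b a) (.pure _))) ?_ rfl
  rcases lt_trichotomy a b with h | h | h
  · simp [h, h.ne]
  · simp [h]
  · simp [h, h.ne']

theorem Computes.tabulate {k : ℕ} {f : Fin k → Prog N n β} {v : Fin k → β} {c : ℕ}
    (h : ∀ i, Computes E (f i) (v i) c) : Computes E (tabulate k f) v (k * (c + 1)) := by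
  induction k with
  | zero => exact (Computes.pure _).of_eq (funext fun i => i.elim0) (by simp)
  | succ k ih =>
    refine Computes.of_eq (.bind (h 0) (.bind (ih fun i => h i.succ)
      (.bind (.work 1) (.pure _)))) ?_ (by ring)
    exact Fin.cons_self_tail v

theorem Computes.sumOver {k : ℕ} {f : Fin k → Prog N n ℝ} {v : Fin k → ℝ} {c : ℕ}
    (h : ∀ i, Computes E (f i) (v i) c) :
    Computes E (sumOver k f) (∑ i, v i) (k * (c + 1)) := by
  induction k with
  | zero => exact (Computes.pure _).of_eq (by simp) (by simp)
  | succ k ih =>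
    exact ((h 0).bind ((ih fun i => h i.succ).bind (Computes.add _ _))).of_eq
      (Fin.sum_univ_succ v).symm (by ring)

theorem Runs.tabulate {k : ℕ} {f : Fin k → Prog N n β} {Q : Fin k → β → Prop} {c : ℕ} {A}
    (h : ∀ i, Runs E (f i) (Q i) c A) :
    Runs E (tabulate k f) (fun v => ∀ i, Q i (v i)) (k * (c + 1)) A := by
  induction k with
  | zero => exact Runs.pure (fun i => i.elim0) _ _
  | succ k ih =>
    refine Runs.mono (.bind (c' := k * (c + 1) + 1) (h 0) fun a ha =>
      .bind (c' := 1) (ih fun i => h i.succ) fun v hv =>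
      .bind (Q := fun _ => True) (c := 1) (c' := 0) (.of (.work 1) trivial le_rfl _) fun _ _ => .pure ?_ _ _) (fun _ h => h)
        (le_of_eq (by ring)) subset_rfl
    intro i
    refine Fin.cases ha (fun j => ?_) i
    exact hv j

theorem Runs.sumOver {k : ℕ} {f : Fin k → Prog N n ℝ} {v : Fin k → ℝ} {c : ℕ} {A}
    (h : ∀ i, Runs E (f i) (· = v i) c A) :
    Runs E (sumOver k f) (· = ∑ i, v i) (k * (c + 1)) A := by
  induction k with
  | zero => exact Runs.pure (by simp) _ _
  | succ k ih =>
    refine Runs.mono (.bind (c' := k * (c + 1) + 1) (h 0) fun a ha =>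
      .bind (c' := 1) (ih fun i => h i.succ) fun s hs =>
      .of (.add _ _) ?_ le_rfl _) (fun _ h => h) (le_of_eq (by ring)) subset_rfl
    rw [ha, hs, Fin.sum_univ_succ]

theorem Runs.prodOver {k : ℕ} {f : Fin k → Prog N n ℝ} {v : Fin k → ℝ} {c : ℕ} {A}
    (h : ∀ i, Runs E (f i) (· = v i) c A) :
    Runs E (prodOver k f) (· = ∏ i, v i) (k * (c + 1)) A := by
  induction k with
  | zero => exact Runs.pure (by simp) _ _
  | succ k ih =>
    refine Runs.mono (.bind (c' := k * (c + 1) + 1) (h 0) fun a ha =>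
      .bind (c' := 1) (ih fun i => h i.succ) fun s hs =>
      .of (.mul _ _) ?_ le_rfl _) (fun _ h => h) (le_of_eq (by ring)) subset_rfl
    rw [ha, hs, Fin.prod_univ_succ]

theorem Computes.power (y : ℝ) (c : ℕ) : Computes E (power y c) (y ^ c) c := by
  induction c with
  | zero => exact (Computes.pure _).of_eq (by simp) rfl
  | succ c ih => exact (ih.bind (Computes.mul _ _)).of_eq (pow_succ y c).symm rfl

theorem Computes.dot {k : ℕ} (u v : Fin k → ℝ) : Computes E (dot u v) (u ⬝ᵥ v) (k * 2) :=
  Computes.sumOver fun _ => Computes.mul _ _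

theorem runs_probeCells (L : List (Fin (n + 1) × Fin N)) {A} (h : ∀ c ∈ L, c ∈ A) :
    Runs E (probeCells L) (fun _ => True) L.length A := by
  induction L with
  | nil => exact Runs.pure trivial _ _
  | cons c L ih =>
    refine (Runs.bind (p := exec (.probe c.1 c.2)) (Q := fun _ => True) (c := 1) ?_ fun _ _ =>
      ih fun c hc => h c (by simp [hc])).mono (fun _ h => h) (by simp [add_comm]) subset_rfl
    have := run_exec E (.probe c.1 c.2)
    constructor <;> simp [this, Instr.cost, Instr.cells, h c]

/-- The cells of the training examples for the features in `A`. -/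
def trainingCells (n : ℕ) {N : ℕ} (A : Finset (Fin N)) : Finset (Fin (n + 1) × Fin N) :=
  (Finset.univ.filter fun s => s ≠ Fin.last n) ×ˢ A

theorem card_trainingCells (A : Finset (Fin N)) : (trainingCells n A).card = n * A.card := by
  rw [trainingCells, Finset.card_product, Finset.filter_ne', Finset.card_erase_of_mem (by simp)]
  simp

theorem trainingCells_mono {A B : Finset (Fin N)} (h : A ⊆ B) :
    trainingCells n A ⊆ trainingCells n B := Finset.product_subset_product_right h

theorem runs_probeTraining (I : List (Fin N)) :
    Runs E (probeTraining I) (fun _ => True) (n * I.length) (trainingCells n I.toFinset) := by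
  refine (runs_probeCells _ fun c hc => ?_).mono (fun _ h => h)
    ((List.length_product _ _).trans (by simp)).le subset_rfl
  obtain ⟨s, i⟩ := c
  replace hc := List.pair_mem_product.1 hc
  obtain ⟨⟨s', rfl⟩, hi⟩ : (∃ s' : Fin n, s'.castSucc = s) ∧ i ∈ I := by simpa using hc
  simp [trainingCells, hi, Fin.castSucc_ne_last]

end Semantics

/-! ### Linear algebra by orthogonalisation -/

section LinearAlgebra

variable {k : ℕ}

/-- The span of the left sides of a list of linear equations. -/
def lhsSpan (Q : List ((Fin k → ℝ) × ℝ)) : Submodule ℝ (Fin k → ℝ) :=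
  Submodule.span ℝ (Prod.fst '' {q | q ∈ Q})

theorem mem_lhsSpan {Q : List ((Fin k → ℝ) × ℝ)} {q : (Fin k → ℝ) × ℝ} (h : q ∈ Q) :
    q.1 ∈ lhsSpan Q := Submodule.subset_span ⟨q, h, rfl⟩

theorem lhsSpan_nil : lhsSpan ([] : List ((Fin k → ℝ) × ℝ)) = ⊥ := by simp [lhsSpan]

theorem lhsSpan_append (Q R : List ((Fin k → ℝ) × ℝ)) :
    lhsSpan (Q ++ R) = lhsSpan Q ⊔ lhsSpan R := by
  rw [lhsSpan, lhsSpan, lhsSpan, ← Submodule.span_union, ← Set.image_union]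
  congr 2
  ext q
  simp

theorem lhsSpan_cons (q : (Fin k → ℝ) × ℝ) (Q : List ((Fin k → ℝ) × ℝ)) :
    lhsSpan (q :: Q) = Submodule.span ℝ {q.1} ⊔ lhsSpan Q := by
  rw [← List.singleton_append, lhsSpan_append]
  simp [lhsSpan]

theorem dotProduct_eq_zero_of_mem_lhsSpan {Q : List ((Fin k → ℝ) × ℝ)} {u v : Fin k → ℝ}
    (h : ∀ q ∈ Q, q.1 ⬝ᵥ u = 0) (hv : v ∈ lhsSpan Q) : v ⬝ᵥ u = 0 := by
  induction hv using Submodule.span_induction with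
  | mem x hx => obtain ⟨q, hq, rfl⟩ := hx; exact h q hq
  | zero => simp
  | add x y _ _ hx hy => simp [hx, hy]
  | smul a x _ hx => simp [hx]

/-- The left sides are nonzero and pairwise orthogonal. -/
structure Orthogonal (Q : List ((Fin k → ℝ) × ℝ)) : Prop where
  pairwise : Q.Pairwise fun q r => q.1 ⬝ᵥ r.1 = 0
  ne_zero : ∀ q ∈ Q, q.1 ≠ 0

theorem Orthogonal.nil : Orthogonal ([] : List ((Fin k → ℝ) × ℝ)) := ⟨.nil, by simp⟩

theorem Orthogonal.snoc {Q : List ((Fin k → ℝ) × ℝ)} (hQ : Orthogonal Q)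
    {r : (Fin k → ℝ) × ℝ} (h : ∀ q ∈ Q, q.1 ⬝ᵥ r.1 = 0) (hr : r.1 ≠ 0) :
    Orthogonal (Q ++ [r]) := by
  refine ⟨List.pairwise_append.2 ⟨hQ.pairwise, by simp, by simpa using fun a b hq => h _ hq⟩, ?_⟩
  intro q hq
  rcases List.mem_append.1 hq with hq | hq
  · exact hQ.ne_zero q hq
  · rw [List.mem_singleton.1 hq]; exact hr

theorem Orthogonal.get_dotProduct_get {Q : List ((Fin k → ℝ) × ℝ)} (hQ : Orthogonal Q)
    {i j : Fin Q.length} (h : i ≠ j) : (Q.get i).1 ⬝ᵥ (Q.get j).1 = 0 := by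
  rcases lt_or_gt_of_ne h with h | h
  · exact List.pairwise_iff_get.1 hQ.pairwise i j h
  · rw [dotProduct_comm]; exact List.pairwise_iff_get.1 hQ.pairwise j i h

theorem Orthogonal.dotProduct_sum {Q : List ((Fin k → ℝ) × ℝ)} (hQ : Orthogonal Q)
    (c : Fin Q.length → ℝ) (j : Fin Q.length) :
    (Q.get j).1 ⬝ᵥ (∑ m, c m • (Q.get m).1) = c j * ((Q.get j).1 ⬝ᵥ (Q.get j).1) := by
  rw [_root_.dotProduct_sum, Finset.sum_eq_single j]
  · simp
  · intro i _ hi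
    rw [dotProduct_smul, hQ.get_dotProduct_get hi.symm, smul_zero]
  · simp

theorem Orthogonal.length_le {Q : List ((Fin k → ℝ) × ℝ)} (hQ : Orthogonal Q) :
    Q.length ≤ k := by
  have hli : LinearIndependent ℝ fun m : Fin Q.length => (Q.get m).1 := by
    refine Fintype.linearIndependent_iff.2 fun c hc j => ?_
    have h := hQ.dotProduct_sum c j
    rw [hc, dotProduct_zero] at h
    refine (mul_eq_zero.1 h.symm).resolve_right fun h0 => ?_
    exact hQ.ne_zero _ (Q.get_mem j) (dotProduct_self_eq_zero.1 h0)
  simpa using hli.fintype_card_le_finrank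

/-- The result of `reduce`. -/
noncomputable def residue :
    List ((Fin k → ℝ) × ℝ) → (Fin k → ℝ) × ℝ → (Fin k → ℝ) × ℝ
  | [], r => r
  | q :: Q, r => residue Q
      (fun i => r.1 i - r.1 ⬝ᵥ q.1 / (q.1 ⬝ᵥ q.1) * q.1 i,
        r.2 - r.1 ⬝ᵥ q.1 / (q.1 ⬝ᵥ q.1) * q.2)

/-- An equation is treated as a single vector of the product space: both sides undergo the same
linear operation, which is why solutions persist (`residue_sat`). -/
theorem residue_cons (q : (Fin k → ℝ) × ℝ) (Q : List ((Fin k → ℝ) × ℝ))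
    (r : (Fin k → ℝ) × ℝ) :
    residue (q :: Q) r = residue Q (r - (r.1 ⬝ᵥ q.1 / (q.1 ⬝ᵥ q.1)) • q) := rfl

theorem sub_residue_mem (Q : List ((Fin k → ℝ) × ℝ)) (r : (Fin k → ℝ) × ℝ) :
    r.1 - (residue Q r).1 ∈ lhsSpan Q := by
  induction Q generalizing r with
  | nil => simp [residue]
  | cons q Q ih =>
    rw [residue_cons, lhsSpan_cons]
    set c := r.1 ⬝ᵥ q.1 / (q.1 ⬝ᵥ q.1)
    have h : r.1 - (residue Q (r - c • q)).1
        = c • q.1 + ((r - c • q).1 - (residue Q (r - c • q)).1) := by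
      simp [← add_sub_assoc]
    rw [h]
    exact Submodule.add_mem_sup (Submodule.smul_mem _ _ (Submodule.mem_span_singleton_self _)) (ih _)

theorem dotProduct_residue {Q : List ((Fin k → ℝ) × ℝ)} {u : Fin k → ℝ}
    (h : ∀ q ∈ Q, u ⬝ᵥ q.1 = 0) (r : (Fin k → ℝ) × ℝ) :
    u ⬝ᵥ (residue Q r).1 = u ⬝ᵥ r.1 := by
  induction Q generalizing r with
  | nil => rfl
  | cons q Q ih =>
    rw [residue_cons, ih fun q hq => h q (by simp [hq])]
    simp [h q (by simp)]

/-- Each step makes the vector orthogonal to one member of `Q`; since the members are pairwise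
orthogonal, the later steps do not change its inner product with that member. -/
theorem Orthogonal.dotProduct_residue {Q : List ((Fin k → ℝ) × ℝ)} (hQ : Orthogonal Q)
    (r : (Fin k → ℝ) × ℝ) : ∀ q ∈ Q, q.1 ⬝ᵥ (residue Q r).1 = 0 := by
  induction Q generalizing r with
  | nil => simp
  | cons q Q ih =>
    have hq := List.pairwise_cons.1 hQ.pairwise
    intro p hp
    rw [residue_cons]
    rcases List.mem_cons.1 hp with rfl | hp
    · rw [LifelongPoly.dotProduct_residue hq.1]
      have h0 : p.1 ⬝ᵥ p.1 ≠ 0 := fun h => hQ.ne_zero p (by simp) (dotProduct_self_eq_zero.1 h)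
      simp [h0, dotProduct_comm r.1]
    · exact ih ⟨hq.2, fun q h => hQ.ne_zero q (by simp [h])⟩ _ p hp

/-- The residue is orthogonal to the span and differs from the vector by an element of the span. If
the vector lies in the span, the residue is orthogonal to itself. -/
theorem Orthogonal.residue_eq_zero_iff {Q : List ((Fin k → ℝ) × ℝ)} (hQ : Orthogonal Q)
    (r : (Fin k → ℝ) × ℝ) : (residue Q r).1 = 0 ↔ r.1 ∈ lhsSpan Q := by
  have h := sub_residue_mem Q r
  constructor
  · intro h0
    simpa [h0] using h
  · intro hr
    exact dotProduct_self_eq_zero.1 (dotProduct_eq_zero_of_mem_lhsSpan (hQ.dotProduct_residue r)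
      ((Submodule.sub_mem_iff_right _ hr).1 h))

theorem residue_sat {Q : List ((Fin k → ℝ) × ℝ)} {w : Fin k → ℝ}
    (hQ : ∀ q ∈ Q, q.1 ⬝ᵥ w = q.2) {r : (Fin k → ℝ) × ℝ} (hr : r.1 ⬝ᵥ w = r.2) :
    (residue Q r).1 ⬝ᵥ w = (residue Q r).2 := by
  induction Q generalizing r with
  | nil => exact hr
  | cons q Q ih =>
    rw [residue_cons]
    exact ih (fun q h => hQ q (by simp [h])) (by simp [hr, hQ q (by simp)])

theorem lhsSpan_snoc_residue (Q : List ((Fin k → ℝ) × ℝ)) (r : (Fin k → ℝ) × ℝ) :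
    lhsSpan (Q ++ [residue Q r]) = lhsSpan Q ⊔ Submodule.span ℝ {r.1} := by
  rw [lhsSpan_append, lhsSpan_cons, lhsSpan_nil, sup_bot_eq]
  have h := sub_residue_mem Q r
  apply le_antisymm
  · refine sup_le le_sup_left (Submodule.span_singleton_le_iff_mem _ _ |>.2 ?_)
    have := Submodule.sub_mem _ (Submodule.mem_sup_right (S := lhsSpan Q)
      (Submodule.mem_span_singleton_self r.1)) (Submodule.mem_sup_left h)
    simpa using this
  · refine sup_le le_sup_left (Submodule.span_singleton_le_iff_mem _ _ |>.2 ?_)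
    have := Submodule.add_mem _ (Submodule.mem_sup_right (S := lhsSpan Q)
      (Submodule.mem_span_singleton_self (residue Q r).1)) (Submodule.mem_sup_left h)
    simpa using this

end LinearAlgebra

/-! ### Correctness and cost of the linear algebra programs. -/

section LinearPrograms

variable {N n : ℕ} {E : Env N n} {k : ℕ}

theorem Computes.reduce (Q : List ((Fin k → ℝ) × ℝ)) (r : (Fin k → ℝ) × ℝ) :
    Computes E (reduce Q r) (residue Q r) (Q.length * (7 * k + 3)) := by
  induction Q generalizing r with
  | nil => exact (Computes.pure _).of_eq rfl (by simp)
  | cons q Q ih =>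
    exact Computes.of_eq (.bind (.dot _ _) (.bind (.dot _ _) (.bind (.div _ _)
      (.bind (.tabulate fun i => .bind (.mul _ _) (.sub _ _)) (.bind (.mul _ _)
        (.bind (.sub _ _) (ih _))))))) rfl (by simp; ring)

open Classical in
-- Over the reals a vector is nonzero iff its inner product with itself is positive, so one
-- comparison decides linear dependence. The pattern is common to `orthogonalize`, `independentRows`
-- and `inColumnSpace`.
theorem Computes.reduceTest (Q : List ((Fin k → ℝ) × ℝ)) (r : (Fin k → ℝ) × ℝ)
    {α : Type} {f : (Fin k → ℝ) × ℝ → Bool → Prog N n α} {a : α} {c : ℕ}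
    (h : Computes E (f (residue Q r) (decide ((residue Q r).1 ≠ 0))) a c) :
    Computes E (do
        let r' ← LifelongPoly.reduce Q r
        let z ← LifelongPoly.dot r'.1 r'.1
        let b ← LifelongPoly.less 0 z
        f r' b) a
      (Q.length * (7 * k + 3) + (k * 2 + (1 + c))) := by
  refine .bind (.reduce Q r) (.bind (.dot _ _) (.bind (.less _ _) ?_))
  convert h using 3
  simpa using Matrix.dotProduct_star_self_pos_iff (v := (residue Q r).1)

open Classical in
theorem Runs.reduceTest (Q : List ((Fin k → ℝ) × ℝ)) (r : (Fin k → ℝ) × ℝ)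
    {α : Type} {f : (Fin k → ℝ) × ℝ → Bool → Prog N n α} {P : α → Prop} {c : ℕ} {A}
    (h : Runs E (f (residue Q r) (decide ((residue Q r).1 ≠ 0))) P c A) :
    Runs E (do
        let r' ← LifelongPoly.reduce Q r
        let z ← LifelongPoly.dot r'.1 r'.1
        let b ← LifelongPoly.less 0 z
        f r' b) P
      (Q.length * (7 * k + 3) + (k * 2 + (1 + c))) A := by
  refine .bind_of (.reduce Q r) (.bind_of (.dot _ _) (.bind_of (.less _ _) ?_))
  convert h using 3
  simpa using Matrix.dotProduct_star_self_pos_iff (v := (residue Q r).1)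

/-- A bound for the number of steps of `orthogonalize` for `r` equations in `k` unknowns, if the
result has at most `q` equations. -/
def orthogonalizeCost {R : Type*} [CommSemiring R] (q r k : R) : R :=
  r * (q * (7 * k + 3) + (k * 2 + 1))

/-- Solutions are only carried forward, from the given equations to the orthogonal ones. The
converse is not needed, because `runs_solve` starts from a solution `w₀` of the given system and
uses the equality of spans. -/
theorem runs_orthogonalize (Q R : List ((Fin k → ℝ) × ℝ)) (hQ : Orthogonal Q) :
    Runs E (orthogonalize Q R) (fun Q' => Orthogonal Q' ∧ lhsSpan Q' = lhsSpan Q ⊔ lhsSpan R ∧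
        Q'.length ≤ Q.length + R.length ∧
        ∀ w, (∀ q ∈ Q, q.1 ⬝ᵥ w = q.2) → (∀ q ∈ R, q.1 ⬝ᵥ w = q.2) → ∀ q ∈ Q', q.1 ⬝ᵥ w = q.2)
      (orthogonalizeCost (Q.length + R.length) R.length k) ∅ := by
  induction R generalizing Q with
  | nil => exact .pure ⟨hQ, by simp [lhsSpan_nil], by simp, fun w h _ => h⟩ _ _
  | cons r R ih =>
    rw [lhsSpan_cons]
    have hcost : Q.length * (7 * k + 3) + (k * 2 + (1 +
        orthogonalizeCost (Q.length + 1 + R.length) R.length k)) ≤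
        orthogonalizeCost (Q.length + (r :: R).length) (r :: R).length k := by
      simp only [orthogonalizeCost, List.length_cons]
      nlinarith [Nat.zero_le ((R.length + 1) * (7 * k + 3))]
    refine (Runs.reduceTest Q r (P := fun Q' => Orthogonal Q' ∧ lhsSpan Q' =
      lhsSpan Q ⊔ (Submodule.span ℝ {r.1} ⊔ lhsSpan R) ∧
        Q'.length ≤ Q.length + (r :: R).length ∧
        ∀ w, (∀ q ∈ Q, q.1 ⬝ᵥ w = q.2) → (∀ q ∈ r :: R, q.1 ⬝ᵥ w = q.2) →
          ∀ q ∈ Q', q.1 ⬝ᵥ w = q.2) (A := ∅)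
      (c := orthogonalizeCost (Q.length + 1 + R.length) R.length k)
      (f := fun r' b => if b then LifelongPoly.orthogonalize (Q ++ [r']) R
        else LifelongPoly.orthogonalize Q R) ?_).mono
      (fun _ h => h) hcost subset_rfl
    by_cases h : (residue Q r).1 = 0
    · simp only [h, ne_eq, not_true_eq_false, decide_false, Bool.false_eq_true, if_false]
      refine (ih Q hQ).mono ?_ (by unfold orthogonalizeCost; gcongr; omega) subset_rfl
      rintro Q' ⟨h1, h2, h3, h4⟩
      refine ⟨h1, ?_, by simp; omega, fun w hw hr => h4 w hw fun q hq => hr q (by simp [hq])⟩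
      rw [h2, ← sup_assoc, (sup_eq_left (a := lhsSpan Q) (b := Submodule.span ℝ {r.1})).2]
      rw [Submodule.span_singleton_le_iff_mem]
      exact (hQ.residue_eq_zero_iff r).1 h
    · simp only [h, ne_eq, not_false_eq_true, decide_true, if_true]
      refine (ih (Q ++ [residue Q r]) (hQ.snoc (hQ.dotProduct_residue r) h)).mono ?_
        (by simp) subset_rfl
      rintro Q' ⟨h1, h2, h3, h4⟩
      refine ⟨h1, ?_, by simp at h3 ⊢; omega, fun w hw hr => h4 w ?_ fun q hq => hr q (by simp [hq])⟩
      · rw [h2, lhsSpan_snoc_residue, sup_assoc]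
      · intro q hq
        rcases List.mem_append.1 hq with hq | hq
        · exact hw q hq
        · rw [List.mem_singleton.1 hq]; exact residue_sat hw (hr r (by simp))

/-- A bound for the number of steps of `solve` for `r` equations in `k` unknowns. -/
def solveCost {R : Type*} [CommSemiring R] (r k : R) : R :=
  orthogonalizeCost r r k + k * (r * (k * 2 + 3) + 1)

/-- An orthogonal system is solved by the combination `w` of its left sides with the Fourier
coefficients. A solution `w₀` of the given system also solves the orthogonal one, so `w - w₀` is
orthogonal to the span of the left sides, which contains the given left sides. -/
theorem runs_solve (R : List ((Fin k → ℝ) × ℝ)) :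
    Runs E (solve R) (fun w => (∃ w₀, ∀ r ∈ R, r.1 ⬝ᵥ w₀ = r.2) → ∀ r ∈ R, r.1 ⬝ᵥ w = r.2)
      (solveCost R.length k) ∅ := by
  refine Runs.mono (.bind (c' := k * (R.length * (k * 2 + 3) + 1)) (runs_orthogonalize [] R .nil)
    fun Q hQ => .of (.tabulate fun l => .sumOver fun m =>
      .bind (.dot _ _) (.bind (.div _ _) (.mul _ _))) ?_ ?_ _) (fun _ h => h) ?_ subset_rfl
  · obtain ⟨h1, h2, -, h4⟩ := hQ
    rintro ⟨w₀, hw₀⟩ r hr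
    set w : Fin k → ℝ := fun l => ∑ m, (Q.get m).2 / ((Q.get m).1 ⬝ᵥ (Q.get m).1) * (Q.get m).1 l
    have hw : w = ∑ m, ((Q.get m).2 / ((Q.get m).1 ⬝ᵥ (Q.get m).1)) • (Q.get m).1 := by
      ext l; simp [w]
    have hQw : ∀ q ∈ Q, q.1 ⬝ᵥ (w - w₀) = 0 := by
      intro q hq
      obtain ⟨j, rfl⟩ := List.get_of_mem hq
      rw [dotProduct_sub, h4 w₀ (by simp) hw₀ _ (Q.get_mem j), hw, h1.dotProduct_sum,
        div_mul_cancel₀, sub_self]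
      exact fun h => h1.ne_zero _ (Q.get_mem j) (dotProduct_self_eq_zero.1 h)
    have hr' : r.1 ∈ lhsSpan Q := by
      rw [h2]; exact Submodule.mem_sup_right (mem_lhsSpan hr)
    have := dotProduct_eq_zero_of_mem_lhsSpan hQw hr'
    rw [dotProduct_sub, sub_eq_zero] at this
    exact this.trans (hw₀ r hr)
  · have := hQ.2.2.1
    simp only [List.length_nil, zero_add] at this
    change k * (Q.length * (k * 2 + 3) + 1) ≤ k * (R.length * (k * 2 + 3) + 1)
    gcongr
  · simp [solveCost]

/-- Maximality is stated through kernels, the form in which lifting uses it. The number of rows is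
bounded because each kept row contributes a new nonzero vector to an orthogonal system in dimension
`F.length`. -/
theorem runs_independentRows (F : Rep N) (Q : List ((Fin F.length → ℝ) × ℝ)) (hQ : Orthogonal Q)
    (L : List (Fin N)) :
    Runs E (independentRows F Q L) (fun I => I.Sublist L ∧ Q.length + I.length ≤ F.length ∧
        ∀ v : Fin F.length → ℝ, (∀ q ∈ Q, q.1 ⬝ᵥ v = 0) → (∀ i ∈ I, row F i ⬝ᵥ v = 0) →
          ∀ i ∈ L, row F i ⬝ᵥ v = 0)
      (orthogonalizeCost F.length L.length F.length) ∅ := by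
  induction L generalizing Q with
  | nil => exact .pure ⟨.slnil, by simpa using hQ.length_le, by simp⟩ _ _
  | cons i L ih =>
    have hcost : Q.length * (7 * F.length + 3) + (F.length * 2 + (1 +
        orthogonalizeCost F.length L.length F.length)) ≤
        orthogonalizeCost F.length (i :: L).length F.length := by
      have : Q.length * (7 * F.length + 3) ≤ F.length * (7 * F.length + 3) := by
        gcongr; exact hQ.length_le
      simp only [orthogonalizeCost, List.length_cons]
      linarith
    refine (Runs.reduceTest Q (row F i, 0) (P := fun I => I.Sublist (i :: L) ∧
        Q.length + I.length ≤ F.length ∧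
        ∀ v : Fin F.length → ℝ, (∀ q ∈ Q, q.1 ⬝ᵥ v = 0) → (∀ i ∈ I, row F i ⬝ᵥ v = 0) →
          ∀ j ∈ i :: L, row F j ⬝ᵥ v = 0) (A := ∅)
      (c := orthogonalizeCost F.length L.length F.length)
      (f := fun r b => if b then do
        let I ← LifelongPoly.independentRows F (Q ++ [r]) L
        pure (i :: I)
      else LifelongPoly.independentRows F Q L) ?_).mono
      (fun _ h => h) hcost subset_rfl
    by_cases h : (residue Q (row F i, 0)).1 = 0
    · simp only [h, ne_eq, not_true_eq_false, decide_false, Bool.false_eq_true, if_false]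
      refine (ih Q hQ).mono ?_ le_rfl subset_rfl
      rintro I ⟨h1, h2, h3⟩
      refine ⟨h1.cons _, h2, fun v hv hI j hj => ?_⟩
      rcases List.mem_cons.1 hj with rfl | hj
      · exact dotProduct_eq_zero_of_mem_lhsSpan hv ((hQ.residue_eq_zero_iff _).1 h)
      · exact h3 v hv hI j hj
    · simp only [h, ne_eq, not_false_eq_true, decide_true, if_true]
      refine Runs.mono (.bind (c' := 0)
        (ih (Q ++ [residue Q (row F i, 0)]) (hQ.snoc (hQ.dotProduct_residue _) h))
        fun I hI => .pure ?_ _ _) (fun _ h => h) le_rfl subset_rfl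
      obtain ⟨h1, h2, h3⟩ := hI
      refine ⟨h1.cons_cons _, by simp at h2 ⊢; omega, fun v hv hI j hj => ?_⟩
      rcases List.mem_cons.1 hj with rfl | hj
      · exact hI j (by simp)
      · refine h3 v ?_ (fun i hi => hI i (by simp [hi])) j hj
        intro q hq
        rcases List.mem_append.1 hq with hq | hq
        · exact hv q hq
        · rw [List.mem_singleton.1 hq]
          -- The new member of the orthogonal system is a residue rather than a row, but it lies in
          -- the span of `Q` and the kept row `i`.
          have hmem := lhsSpan_snoc_residue Q (row F i, 0)
          have : (residue Q (row F i, 0)).1 ∈ lhsSpan (Q ++ [(row F i, 0)]) := by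
            rw [lhsSpan_append, lhsSpan_cons, lhsSpan_nil, sup_bot_eq, ← hmem]
            exact mem_lhsSpan (by simp)
          refine dotProduct_eq_zero_of_mem_lhsSpan ?_ this
          intro p hp
          rcases List.mem_append.1 hp with hp | hp
          · exact hv p hp
          · rw [List.mem_singleton.1 hp]; exact hI i (by simp)

/-- The column space of a representation. -/
def colSpan (F : Rep N) : Submodule ℝ (Fin N → ℝ) := Submodule.span ℝ (vec '' {f | f ∈ F})

theorem lhsSpan_map_vec (F : Rep N) : lhsSpan (F.map fun f => (vec f, (0 : ℝ))) = colSpan F := by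
  rw [lhsSpan, colSpan]
  congr 1
  ext v
  simp

theorem mem_colSpan_iff (F : Rep N) (v : Fin N → ℝ) :
    v ∈ colSpan F ↔ ∃ w : Fin F.length → ℝ, ∀ i, row F i ⬝ᵥ w = v i := by
  have : vec '' {f | f ∈ F} = Set.range fun l : Fin F.length => vec (F.get l) := by
    ext v
    simp [List.mem_iff_get, ← exists_and_right]
  rw [colSpan, this, Submodule.mem_span_range_iff_exists_fun]
  refine exists_congr fun w => ?_
  rw [funext_iff]
  simp [row, vec, dotProduct, mul_comm]

/-- A bound for the number of steps of `inColumnSpace` for a representation with `f` columns. -/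
def inColumnSpaceCost {R : Type*} [CommSemiring R] (N f : R) : R :=
  orthogonalizeCost f f N + (f * (7 * N + 3) + (N * 2 + 1))

open Classical in
theorem runs_inColumnSpace (F : Rep N) (g : Fin N →₀ ℕ) :
    Runs E (inColumnSpace F g) (· = decide (vec g ∈ colSpan F))
      (inColumnSpaceCost N F.length) ∅ := by
  refine Runs.mono (.bind (c' := F.length * (7 * N + 3) + (N * 2 + 1))
    (runs_orthogonalize [] (F.map fun f => (vec f, (0 : ℝ))) .nil) fun Q hQ =>
      .of (.reduceTest Q (vec g, 0) (.pure _)) ?_ ?_ _) (fun _ h => h) ?_ subset_rfl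
  · obtain ⟨h1, h2, -⟩ := hQ
    have h := h1.residue_eq_zero_iff (vec g, 0)
    rw [h2, lhsSpan_nil, bot_sup_eq, lhsSpan_map_vec] at h
    simp [h]
  · have := hQ.2.2.1
    simp only [List.length_nil, zero_add, List.length_map] at this
    gcongr
  · simp [inColumnSpaceCost]

/-- Membership is tested against the growing matrix, which preserves independence. The first
monomial outside the original column space still meets the original matrix and is added, hence the
strict growth. -/
theorem runs_improveRep (L : List (Term N)) (F : Rep N) (M : ℕ) (hM : F.length + L.length ≤ M) :
    Runs E (improveRep L F) (fun F' => F.length ≤ F'.length ∧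
        (∀ f ∈ F', f ∈ F ∨ ∃ u ∈ L, u.1 = f) ∧
        (F.Nodup ∧ LinearIndepOn ℝ vec {f | f ∈ F} →
          F'.Nodup ∧ LinearIndepOn ℝ vec {f | f ∈ F'}) ∧
        ((∃ u ∈ L, vec u.1 ∉ colSpan F) → F.length < F'.length))
      (L.length * inColumnSpaceCost N M) ∅ := by
  induction L generalizing F with
  | nil => exact .pure (by simp) _ _
  | cons u L ih =>
    refine Runs.mono (.bind (c' := L.length * inColumnSpaceCost N M) (runs_inColumnSpace F u.1)
      fun b hb => (ih _ ?_).mono ?_ le_rfl subset_rfl) (fun _ h => h) ?_ subset_rfl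
    · simp only [List.length_cons] at hM
      split_ifs
      · omega
      · rw [List.length_append, List.length_singleton]; omega
    · subst hb
      by_cases h : vec u.1 ∈ colSpan F
      · simp only [h, decide_true, if_true]
        rintro F' ⟨h1, h2, h3, h4⟩
        refine ⟨h1, fun f hf => (h2 f hf).imp_right fun ⟨u, hu, h⟩ => ⟨u, by simp [hu], h⟩, h3, ?_⟩
        rintro ⟨v, hv, hvF⟩
        rcases List.mem_cons.1 hv with rfl | hv
        · exact absurd h hvF
        · exact h4 ⟨v, hv, hvF⟩
      · simp only [h, decide_false, Bool.false_eq_true, if_false]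
        rintro F' ⟨h1, h2, h3, -⟩
        simp only [List.length_append, List.length_singleton] at h1
        refine ⟨by omega, fun f hf => ?_, fun ⟨hn, hl⟩ => h3 ⟨?_, ?_⟩, fun _ => by omega⟩
        · rcases h2 f hf with h | ⟨v, hv, h⟩
          · rcases List.mem_append.1 h with h | h
            · exact .inl h
            · exact .inr ⟨u, by simp, (List.mem_singleton.1 h).symm⟩
          · exact .inr ⟨v, by simp [hv], h⟩
        · refine List.Nodup.append hn (by simp) ?_
          rw [List.disjoint_singleton]
          exact fun h' => h (Submodule.subset_span ⟨_, h', rfl⟩)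
        · have : {f | f ∈ F ++ [u.1]} = insert u.1 {f | f ∈ F} := by ext; simp [or_comm]
          rw [this]
          exact hl.insert h
    · have : inColumnSpaceCost N F.length ≤ inColumnSpaceCost N M := by
        unfold inColumnSpaceCost orthogonalizeCost
        have : F.length ≤ M := by omega
        gcongr
      simp only [List.length_cons] at this ⊢
      linarith

theorem Blind.of_computes {α : Type} {p : Prog N n α} {a : α} {c : ℕ}
    (h : ∀ E, Computes E p a c) : Blind p := fun _ _ _ _ => by
  rw [(h _).value, (h _).value]

theorem Blind.tabulate {β : Type} {k : ℕ} {f : Fin k → Prog N n β} (h : ∀ i, Blind (f i)) :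
    Blind (tabulate k f) := by
  induction k with
  | zero => exact .pure _
  | succ k ih =>
    exact .bind (h 0) fun a => .bind (ih fun i => h i.succ) fun v => .bind (.unit _) fun _ => .pure _

theorem Blind.orthogonalize (Q R : List ((Fin k → ℝ) × ℝ)) :
    Blind (orthogonalize Q R : Prog N n _) := by
  induction R generalizing Q with
  | nil => exact .pure _
  | cons r R ih =>
    refine .bind (.of_computes fun E => .reduce Q r) fun r' =>
      .bind (.of_computes fun E => .dot _ _) fun z => .bind (.less _ _) fun b => ?_
    split_ifs <;> exact ih _

theorem Blind.solve (R : List ((Fin k → ℝ) × ℝ)) : Blind (solve R : Prog N n _) :=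
  .bind (.orthogonalize _ _) fun _ => .of_computes fun _ => .tabulate fun _ => .sumOver fun _ =>
      .bind (.dot _ _) (.bind (.div _ _) (.mul _ _))

theorem Blind.independentRows (F : Rep N) (Q : List ((Fin F.length → ℝ) × ℝ))
    (L : List (Fin N)) : Blind (independentRows F Q L : Prog N n _) := by
  induction L generalizing Q with
  | nil => exact .pure _
  | cons i L ih =>
    refine .bind (.of_computes fun E => .reduce Q _) fun r' =>
      .bind (.of_computes fun E => .dot _ _) fun z => .bind (.less _ _) fun b => ?_
    split_ifs
    · exact .bind (ih _) fun _ => .pure _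
    · exact ih _

end LinearPrograms

/-! ### Zeros of polynomials under atomless product measures -/

theorem ae_polynomial_eval_ne_zero (μ : Measure ℝ) [NullSingletonClass μ] {p : Polynomial ℝ} (hp : p ≠ 0) :
    ∀ᵐ y ∂μ, p.eval y ≠ 0 := by
  rw [ae_iff]
  simp only [not_not]
  exact (Polynomial.finite_setOfPred_isRoot hp).measure_zero μ

/-- Fubini and induction: as a polynomial in the first variable, `P` has a nonzero leading
coefficient in the other variables. Where this coefficient does not vanish, which is almost
everywhere, the remaining univariate polynomial is nonzero and its roots form a null set. -/
theorem ae_mvPolynomial_eval_ne_zero {N : ℕ} (μ : Fin N → Measure ℝ)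
    [∀ i, IsProbabilityMeasure (μ i)] [∀ i, NullSingletonClass (μ i)] {P : MvPolynomial (Fin N) ℝ}
    (hP : P ≠ 0) : ∀ᵐ x ∂Measure.pi μ, MvPolynomial.eval x P ≠ 0 := by
  induction N with
  | zero =>
    refine .of_forall fun x h => hP ?_
    rw [MvPolynomial.eq_C_of_isEmpty P] at h ⊢
    rw [MvPolynomial.eval_C] at h
    rw [h, map_zero]
  | succ N ih =>
    set p := MvPolynomial.finSuccEquiv ℝ N P
    have hp : p ≠ 0 := by simpa [p] using hP
    have h1 := ih (fun j => μ j.succ) (Polynomial.leadingCoeff_ne_zero.2 hp)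
    have h2 : ∀ᵐ z ∂(Measure.pi fun j => μ (Fin.succAbove 0 j)).prod (μ 0),
        MvPolynomial.eval (Fin.cons z.2 z.1 : Fin (N + 1) → ℝ) P ≠ 0 := by
      rw [Measure.ae_prod_iff_ae_ae]
      · filter_upwards [h1] with s hs
        have hs' : p.map (MvPolynomial.eval s) ≠ 0 := fun h => hs (by
          have := congrArg (Polynomial.coeff · p.natDegree) h
          simpa using this)
        filter_upwards [ae_polynomial_eval_ne_zero (μ 0) hs'] with y hy
        rwa [MvPolynomial.eval_eq_eval_mv_eval']
      · have hs : Continuous fun z : (Fin N → ℝ) × ℝ => (Fin.cons z.2 z.1 : Fin (N + 1) → ℝ) :=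
          continuous_pi (Fin.cases continuous_snd fun j => (continuous_apply j).comp continuous_fst)
        have hc : Continuous fun z : (Fin N → ℝ) × ℝ =>
            MvPolynomial.eval (Fin.cons z.2 z.1 : Fin (N + 1) → ℝ) P :=
          (MvPolynomial.continuous_eval P).comp hs
        exact (measurableSet_singleton 0).compl.preimage hc.measurable
    -- Splitting off the first coordinate puts it first; the swap makes it the inner variable of the
    -- Fubini argument.
    have h3 := (Measure.measurePreserving_swap.comp
      (measurePreserving_piFinSuccAbove μ 0)).quasiMeasurePreserving.ae h2
    filter_upwards [h3] with x hx
    convert hx using 3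
    exact (Fin.cons_self_tail x).symm

/-! ### Moments and products of univariate polynomials -/

/-- The value at `y` of the univariate polynomial with coefficients `u`. -/
noncomputable def evalCoeffs {w : ℕ} (u : Fin w → ℝ) (y : ℝ) : ℝ := ∑ k : Fin w, u k * y ^ (k : ℕ)

/-- The `k`-th moment of `μ` weighted with the polynomial with coefficients `u`. -/
noncomputable def wMoment (μ : Measure ℝ) {w : ℕ} (u : Fin w → ℝ) (k : ℕ) : ℝ :=
  ∫ y, evalCoeffs u y * y ^ k ∂μ

/-- Domination by `1 + y^(4d)`. The order `4d` is what a correlation with a square involves in one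
variable: `2d` from the orthonormal polynomial and `2d` from the square. -/
theorem integrable_pow_of_le {μ : Measure ℝ} [IsFiniteMeasure μ] {d : ℕ}
    (h : Integrable (fun y : ℝ => y ^ (4 * d)) μ) {k : ℕ} (hk : k ≤ 4 * d) :
    Integrable (fun y : ℝ => y ^ k) μ := by
  refine ((integrable_const (1 : ℝ)).add h).mono' (by fun_prop) (.of_forall fun y => ?_)
  have hy : y ^ (4 * d) = |y| ^ (4 * d) := (Even.pow_abs ⟨2 * d, by ring⟩ y).symm
  simp only [Pi.add_apply, norm_pow, Real.norm_eq_abs, hy]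
  rcases le_total |y| 1 with h1 | h1
  · have := pow_le_one₀ (n := k) (abs_nonneg y) h1
    have := pow_nonneg (abs_nonneg y) (4 * d)
    linarith
  · have := pow_le_pow_right₀ h1 hk
    linarith

section

variable {d : ℕ} {μ : Measure ℝ} [IsProbabilityMeasure μ]

theorem integrable_evalCoeffs_mul_pow (h : Integrable (fun y : ℝ => y ^ (4 * d)) μ)
    (u : Fin (2 * d + 1) → ℝ) {k : ℕ} (hk : k ≤ 2 * d) :
    Integrable (fun y => evalCoeffs u y * y ^ k) μ := by
  simp only [evalCoeffs, Finset.sum_mul, mul_assoc, ← pow_add]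
  exact integrable_finsetSum _ fun a _ => (integrable_pow_of_le h (by omega)).const_mul _

theorem wMoment_eq_sum (h : Integrable (fun y : ℝ => y ^ (4 * d)) μ)
    (u : Fin (2 * d + 1) → ℝ) {k : ℕ} (hk : k ≤ 2 * d) :
    wMoment μ u k = ∑ a, u a * ∫ y, y ^ (a + k : ℕ) ∂μ := by
  simp only [wMoment, evalCoeffs, Finset.sum_mul, mul_assoc, ← pow_add]
  rw [integral_finsetSum _ fun a _ => (integrable_pow_of_le h (by omega)).const_mul _]
  exact Finset.sum_congr rfl fun a _ => integral_const_mul _ _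

end

/-! ### Correlations as finite sums of products of weighted moments. -/

section Product

variable {N d : ℕ} {μ : Fin N → Measure ℝ} [∀ i, IsProbabilityMeasure (μ i)]

theorem integrable_prod_evalCoeffs (hμ : ∀ i, Integrable (fun y : ℝ => y ^ (4 * d)) (μ i))
    (h : Fin N → Fin (2 * d + 1) → ℝ) {g : Fin N → ℕ} (hg : ∀ i, g i ≤ 2 * d) :
    Integrable (fun x => ∏ i, (evalCoeffs (h i) (x i) * x i ^ g i)) (Measure.pi μ) :=
  Integrable.fintype_prod_dep fun i => integrable_evalCoeffs_mul_pow (hμ i) (h i) (hg i)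

theorem integral_prod_evalCoeffs (h : Fin N → Fin (2 * d + 1) → ℝ) (g : Fin N → ℕ) :
    ∫ x, ∏ i, (evalCoeffs (h i) (x i) * x i ^ g i) ∂(Measure.pi μ) = ∏ i, wMoment (μ i) (h i) (g i) :=
  integral_fintype_prod_eq_prod (μ := μ) fun i y => evalCoeffs (h i) y * y ^ g i

/-- The index type is arbitrary and the exponents `r` are separate from it, so that a square, as a
sum over pairs with added exponents, is another instance. -/
theorem integral_prod_mul_sum (hμ : ∀ i, Integrable (fun y : ℝ => y ^ (4 * d)) (μ i))
    (h : Fin N → Fin (2 * d + 1) → ℝ) {ι : Type*} (T : Finset ι) (c : ι → ℝ)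
    (r : ι → Fin N → ℕ) (hr : ∀ g ∈ T, ∀ i, r g i ≤ 2 * d) :
    Integrable (fun x => (∏ i, evalCoeffs (h i) (x i)) * ∑ g ∈ T, c g * ∏ i, x i ^ r g i)
      (Measure.pi μ) ∧
    ∫ x, (∏ i, evalCoeffs (h i) (x i)) * ∑ g ∈ T, c g * ∏ i, x i ^ r g i ∂(Measure.pi μ) =
      ∑ g ∈ T, c g * ∏ i, wMoment (μ i) (h i) (r g i) := by
  have hrw : (fun x : Fin N → ℝ =>
      (∏ i, evalCoeffs (h i) (x i)) * ∑ g ∈ T, c g * ∏ i, x i ^ r g i) =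
      fun x => ∑ g ∈ T, c g * ∏ i, (evalCoeffs (h i) (x i) * x i ^ r g i) := by
    ext x
    rw [Finset.mul_sum]
    refine Finset.sum_congr rfl fun g _ => ?_
    rw [Finset.prod_mul_distrib]
    ring
  have hi : ∀ g ∈ T, Integrable (fun x : Fin N → ℝ =>
      c g * ∏ i, (evalCoeffs (h i) (x i) * x i ^ r g i)) (Measure.pi μ) := fun g hg =>
    (integrable_prod_evalCoeffs hμ h (hr g hg)).const_mul _
  rw [hrw]
  refine ⟨integrable_finsetSum _ hi, ?_⟩
  rw [integral_finsetSum _ hi]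
  refine Finset.sum_congr rfl fun g _ => ?_
  rw [integral_const_mul, integral_prod_evalCoeffs]

theorem integral_prod_mul_sum_sq (hμ : ∀ i, Integrable (fun y : ℝ => y ^ (4 * d)) (μ i))
    (h : Fin N → Fin (2 * d + 1) → ℝ) {ι : Type*} (T : Finset ι) (c : ι → ℝ)
    (r : ι → Fin N → ℕ) (hr : ∀ g ∈ T, ∀ i, r g i ≤ d) :
    Integrable (fun x => (∏ i, evalCoeffs (h i) (x i)) * (∑ g ∈ T, c g * ∏ i, x i ^ r g i) ^ 2)
      (Measure.pi μ) ∧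
    ∫ x, (∏ i, evalCoeffs (h i) (x i)) * (∑ g ∈ T, c g * ∏ i, x i ^ r g i) ^ 2 ∂(Measure.pi μ) =
      ∑ p ∈ T ×ˢ T, c p.1 * c p.2 * ∏ i, wMoment (μ i) (h i) (r p.1 i + r p.2 i) := by
  have := integral_prod_mul_sum hμ h (T ×ˢ T) (fun p => c p.1 * c p.2)
    (fun p i => r p.1 i + r p.2 i) (fun p hp i => by
      have := hr _ (Finset.mem_product.1 hp).1 i
      have := hr _ (Finset.mem_product.1 hp).2 i
      omega)
  convert this using 6 with x x
  all_goals
    rw [sq, Finset.sum_mul_sum, ← Finset.sum_product']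
    refine Finset.sum_congr rfl fun p _ => ?_
    simp only [pow_add, Finset.prod_mul_distrib]
    ring

end Product

/-! ### Orthonormal polynomials -/

/-- The properties of the coefficients of the orthonormal polynomials of degree `0, …, 2d` that the
learner depends on. -/
structure IsOrthonormalInventory (μ : Measure ℝ) {d : ℕ}
    (H : Fin (2 * d + 1) → Fin (2 * d + 1) → ℝ) : Prop where
  apply_eq_zero : ∀ c a : Fin (2 * d + 1), c < a → H c a = 0
  pos : ∀ c, 0 < H c c
  wMoment_eq_zero : ∀ (c : Fin (2 * d + 1)) (j : ℕ), j < c → wMoment μ (H c) j = 0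
  mul_wMoment : ∀ c, H c c * wMoment μ (H c) c = 1
  zero_zero : H 0 0 = 1

/-! ### The Gram-Schmidt process for a symmetric positive definite form. -/

section GramSchmidt

open Matrix

variable {D : ℕ}

/-- The rows of `H` result from the Gram-Schmidt process for the bilinear form `G`, applied to the
first `k` unit vectors. -/
structure IsGramSchmidt (G : Matrix (Fin D) (Fin D) ℝ) {k : ℕ} (H : Fin k → Fin D → ℝ) : Prop where
  apply_eq_zero : ∀ (l : Fin k) (a : Fin D), (l : ℕ) < a → H l a = 0
  pos : ∀ (l : Fin k) (a : Fin D), (a : ℕ) = l → 0 < H l a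
  orthonormal : ∀ l l', H l ⬝ᵥ G *ᵥ H l' = if l = l' then 1 else 0
  mem_span : ∀ j : Fin D, (j : ℕ) < k → Pi.single j 1 ∈ Submodule.span ℝ (Set.range H)
  single_eq_zero : ∀ (l : Fin k) (j : Fin D), (j : ℕ) < l → Pi.single j 1 ⬝ᵥ G *ᵥ H l = 0
  mul_single : ∀ (l : Fin k) (j : Fin D), (j : ℕ) = l → H l j * (Pi.single j 1 ⬝ᵥ G *ᵥ H l) = 1

/-- The invariant includes that the unit vectors treated so far lie in the span of the rows: this
turns orthogonality to the earlier rows into orthogonality to all lower powers. -/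
theorem IsGramSchmidt.snoc {G : Matrix (Fin D) (Fin D) ℝ} (hG : G.IsSymm)
    (hpos : ∀ u : Fin D → ℝ, u ≠ 0 → 0 < u ⬝ᵥ G *ᵥ u) {k : ℕ} {H : Fin k → Fin D → ℝ}
    (hH : IsGramSchmidt G H) (hk : k < D) {v : Fin D → ℝ}
    (hv : v = Pi.single ⟨k, hk⟩ 1 - ∑ l, (Pi.single ⟨k, hk⟩ 1 ⬝ᵥ G *ᵥ H l) • H l) :
    IsGramSchmidt G (Fin.snoc (α := fun _ => Fin D → ℝ) H fun a => v a / √(v ⬝ᵥ G *ᵥ v)) := by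
  set e : Fin D → ℝ := Pi.single ⟨k, hk⟩ 1
  have hcomm : ∀ u w : Fin D → ℝ, u ⬝ᵥ G *ᵥ w = w ⬝ᵥ G *ᵥ u := fun u w => by
    rw [dotProduct_mulVec, ← mulVec_transpose, hG.eq, dotProduct_comm]
  -- The earlier rows have no entry at position `k`, so the projection leaves the leading
  -- coefficient `1`; after normalisation it is `1 / r`.
  have hvk : v ⟨k, hk⟩ = 1 := by
    rw [hv]
    simp only [Pi.sub_apply, e, Pi.single_eq_same, Finset.sum_apply, Pi.smul_apply]
    rw [Finset.sum_eq_zero, sub_zero]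
    intro l _
    rw [hH.apply_eq_zero l ⟨k, hk⟩ l.2, smul_zero]
  have hva : ∀ a : Fin D, k < a → v a = 0 := fun a ha => by
    rw [hv]
    simp only [Pi.sub_apply, e, Finset.sum_apply, Pi.smul_apply]
    rw [Finset.sum_eq_zero, sub_zero, Pi.single_eq_of_ne]
    · exact fun h => by simp [h] at ha
    · intro l _
      rw [hH.apply_eq_zero l a (l.2.trans ha), smul_zero]
  have hvH : ∀ l, v ⬝ᵥ G *ᵥ H l = 0 := fun l => by
    rw [hv, sub_dotProduct, sum_dotProduct, Finset.sum_eq_single l]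
    · simp [hH.orthonormal]
    · intro l' _ hl'
      rw [smul_dotProduct, hH.orthonormal, if_neg hl', smul_zero]
    · simp
  have hv0 : v ≠ 0 := fun h => by simp [h] at hvk
  set r := √(v ⬝ᵥ G *ᵥ v)
  have hr : 0 < r := Real.sqrt_pos.2 (hpos v hv0)
  have hrr : r * r = v ⬝ᵥ G *ᵥ v := Real.mul_self_sqrt (hpos v hv0).le
  set h : Fin D → ℝ := fun a => v a / r
  have hh : h = r⁻¹ • v := by ext a; simp [h, div_eq_inv_mul]
  have hhH : ∀ l, h ⬝ᵥ G *ᵥ H l = 0 := fun l => by rw [hh, smul_dotProduct, hvH, smul_zero]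
  have hhh : h ⬝ᵥ G *ᵥ h = 1 := by
    rw [hh, smul_dotProduct, mulVec_smul, dotProduct_smul, ← hrr, smul_eq_mul, smul_eq_mul]
    field_simp
  have hrange : Set.range (Fin.snoc (α := fun _ => Fin D → ℝ) H h) = insert h (Set.range H) := by
    ext u
    simp only [Set.mem_range, Set.mem_insert_iff]
    constructor
    · rintro ⟨l, rfl⟩
      refine Fin.lastCases ?_ (fun l => ?_) l
      · simp
      · exact .inr ⟨l, by simp⟩
    · rintro (rfl | ⟨l, rfl⟩)
      · exact ⟨Fin.last k, by simp⟩
      · exact ⟨l.castSucc, by simp⟩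
  refine ⟨fun l => ?_, fun l => ?_, fun l l' => ?_, fun j hj => ?_, fun l => ?_, fun l => ?_⟩
  · refine Fin.lastCases (fun a ha => ?_) (fun l a ha => ?_) l
    · simp only [Fin.snoc_last, h, hva a (by simpa using ha), zero_div]
    · simpa using hH.apply_eq_zero l a (by simpa using ha)
  · refine Fin.lastCases (fun a ha => ?_) (fun l a ha => ?_) l
    · have : a = ⟨k, hk⟩ := Fin.ext (by simpa using ha)
      simp only [Fin.snoc_last, h, this, hvk]
      positivity
    · simpa using hH.pos l a (by simpa using ha)
  · refine Fin.lastCases ?_ (fun l => ?_) l <;> refine Fin.lastCases ?_ (fun l' => ?_) l'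
    · simp [hhh]
    · simp [hhH, Fin.ext_iff, l'.2.ne']
    · simp [hcomm _ h, hhH, Fin.ext_iff, l.2.ne]
    · simp [hH.orthonormal]
  · rw [hrange]
    rcases Nat.lt_succ_iff_lt_or_eq.1 hj with hj | hj
    · exact Submodule.span_mono (Set.subset_insert _ _) (hH.mem_span j hj)
    · have hj' : (Pi.single j 1 : Fin D → ℝ) = e := by
        have : j = ⟨k, hk⟩ := Fin.ext hj
        rw [this]
      have : e = r • h + ∑ l, (e ⬝ᵥ G *ᵥ H l) • H l := by
        rw [hh, smul_smul, mul_inv_cancel₀ hr.ne', one_smul, hv, sub_add_cancel]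
      rw [hj', this]
      refine Submodule.add_mem _ (Submodule.smul_mem _ _ (Submodule.subset_span (by simp)))
        (Submodule.sum_mem _ fun l _ => Submodule.smul_mem _ _ (Submodule.subset_span ?_))
      exact .inr ⟨l, rfl⟩
  · refine Fin.lastCases (fun j hj => ?_) (fun l j hj => ?_) l
    · have hmem := hH.mem_span j (by simpa using hj)
      simp only [Fin.snoc_last]
      generalize (Pi.single j 1 : Fin D → ℝ) = x at hmem
      induction hmem using Submodule.span_induction with
      | mem x hx => obtain ⟨l, rfl⟩ := hx; rw [hcomm, hhH]
      | zero => simp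
      | add x y _ _ hx hy => rw [add_dotProduct, hx, hy, add_zero]
      | smul a x _ hx => rw [smul_dotProduct, hx, smul_zero]
    · simpa using hH.single_eq_zero l j (by simpa using hj)
  · refine Fin.lastCases (fun j hj => ?_) (fun l j hj => ?_) l
    · have : j = ⟨k, hk⟩ := Fin.ext (by simpa using hj)
      subst this
      have he : e = v + ∑ l, (e ⬝ᵥ G *ᵥ H l) • H l := by rw [hv, sub_add_cancel]
      -- `e` and `v` differ by vectors orthogonal to `h`, so the pairing is that of `v` with `h`,
      -- the inverse of the leading coefficient of `h`.
      have h0 : e ⬝ᵥ G *ᵥ h = r := by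
        rw [he, add_dotProduct, sum_dotProduct, Finset.sum_eq_zero, add_zero, hh, mulVec_smul,
          dotProduct_smul, ← hrr, smul_eq_mul, inv_mul_cancel_left₀ hr.ne']
        intro l _
        rw [smul_dotProduct, hcomm (H l) h, hhH, smul_zero]
      simp only [Fin.snoc_last]
      change h ⟨k, hk⟩ * (e ⬝ᵥ G *ᵥ h) = 1
      rw [h0]
      simp only [h, hvk]
      field_simp
    · simpa using hH.mul_single l j (by simpa using hj)

end GramSchmidt

/-! ### The inventory computed from the moments. -/

section Inventory

open Matrix

variable {N n d : ℕ} {E : Env N n}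

/-- The matrix of the bilinear form with the moments `M`. -/
def momentMatrix {d : ℕ} (M : Fin (4 * d + 1) → ℝ) :
    Matrix (Fin (2 * d + 1)) (Fin (2 * d + 1)) ℝ := fun a b => M ⟨a + b, by omega⟩

theorem Computes.polyInner (M : Fin (4 * d + 1) → ℝ) (u v : Fin (2 * d + 1) → ℝ) :
    Computes E (polyInner M u v) (u ⬝ᵥ momentMatrix M *ᵥ v)
      ((2 * d + 1) * ((2 * d + 1) * 3 + 1)) := by
  refine Computes.of_eq (.sumOver fun a => .sumOver fun b => .bind (.mul _ _) (.mul _ _)) ?_ rfl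
  simp only [dotProduct, mulVec, momentMatrix, Finset.mul_sum]
  exact Finset.sum_congr rfl fun a _ => Finset.sum_congr rfl fun b _ => by ring

/-- A bound for the number of steps for one orthonormal polynomial, of which there are `D`. -/
def gramSchmidtCost {R : Type*} [CommSemiring R] (D : R) : R :=
  D * (D * (D * 3 + 1) + 1) + (D * (D * 2 + 2) + (D * (D * 3 + 1) + (1 + D * 2)))

theorem runs_orthonormalPolys (M : Fin (4 * d + 1) → ℝ)
    (hpos : ∀ u : Fin (2 * d + 1) → ℝ, u ≠ 0 → 0 < u ⬝ᵥ momentMatrix M *ᵥ u)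
    {k : ℕ} (hk : k ≤ 2 * d + 1) :
    Runs E (orthonormalPolys M k) (IsGramSchmidt (momentMatrix M))
      (k * gramSchmidtCost (2 * d + 1)) ∅ := by
  induction k with
  | zero =>
    refine .pure ⟨?_, ?_, ?_, ?_, ?_, ?_⟩ _ _
    all_goals first | exact fun l => l.elim0 | exact fun j hj => absurd hj (Nat.not_lt_zero _)
  | succ k ih =>
    refine Runs.mono (.bind (c' := gramSchmidtCost (2 * d + 1)) (ih (by omega)) fun H hH =>
      Runs.mono (.bind_of (.tabulate fun l => .polyInner M _ (H l))
        (.bind_of (.tabulate fun a => .bind (.sumOver fun l => .mul _ _) (.sub _ _))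
          (.bind_of (.polyInner M _ _) (.bind_of (.sqrt _)
            (.bind_of (.tabulate fun a => .div _ _) (.pure ?_ 0 _))))))
        (fun _ h => h) ?_ subset_rfl) (fun _ h => h) ?_ subset_rfl
    · refine hH.snoc ?_ hpos hk ?_
      · ext a b
        simp [momentMatrix, Matrix.transpose_apply, add_comm]
      · have he : (fun a : Fin (2 * d + 1) => if (a : ℕ) = k then (1 : ℝ) else 0) =
            Pi.single ⟨k, hk⟩ 1 := by
          ext a
          simp [Pi.single_apply, Fin.ext_iff]
        rw [← he]
        ext a
        simp
    · have hk' : k ≤ 2 * d + 1 := by omega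
      unfold gramSchmidtCost
      have h1 : k * ((2 * d + 1) * ((2 * d + 1) * 3 + 1) + 1) ≤
        (2 * d + 1) * ((2 * d + 1) * ((2 * d + 1) * 3 + 1) + 1) := by gcongr
      have h2 : (2 * d + 1) * (k * 2 + 2) ≤ (2 * d + 1) * ((2 * d + 1) * 2 + 2) := by gcongr
      linarith
    · exact le_of_eq (by ring)

/-- A bound for the number of steps of `inventory`. -/
def inventoryCost {R : Type*} [CommSemiring R] (N d : R) : R :=
  N * ((4 * d + 1) * 2 + (2 * d + 1) * gramSchmidtCost (2 * d + 1) + 1)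

/-- The quadratic form of the moment matrix is `𝔼[u(y)²]`, and a nonzero polynomial has only a null
set of roots. So the Gram-Schmidt process never divides by zero. -/
theorem evalCoeffs_mul_self_pos {μ : Measure ℝ} [IsProbabilityMeasure μ] [NullSingletonClass μ]
    (h : Integrable (fun y : ℝ => y ^ (4 * d)) μ) {u : Fin (2 * d + 1) → ℝ} (hu : u ≠ 0) :
    0 < ∑ a : Fin (2 * d + 1), u a * wMoment μ u a := by
  have hsum : ∑ a : Fin (2 * d + 1), u a * wMoment μ u a = ∫ y, evalCoeffs u y ^ 2 ∂μ := by
    simp only [wMoment, ← integral_const_mul]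
    rw [← integral_finsetSum _ fun a _ =>
      (integrable_evalCoeffs_mul_pow h u (by omega)).const_mul _]
    refine integral_congr_ae (.of_forall fun y => ?_)
    simp only [sq]
    rw [evalCoeffs, Finset.mul_sum]
    exact Finset.sum_congr rfl fun a _ => by ring
  have hint : Integrable (fun y => evalCoeffs u y ^ 2) μ := by
    have : (fun y => evalCoeffs u y ^ 2) =
        fun y => ∑ a : Fin (2 * d + 1), u a * (evalCoeffs u y * y ^ (a : ℕ)) := by
      ext y
      rw [sq]
      nth_rewrite 2 [evalCoeffs]
      rw [Finset.mul_sum]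
      exact Finset.sum_congr rfl fun a _ => by ring
    rw [this]
    exact integrable_finsetSum _ fun a _ =>
      (integrable_evalCoeffs_mul_pow h u (by omega)).const_mul _
  rw [hsum, integral_pos_iff_support_of_nonneg (fun y => sq_nonneg _) hint]
  obtain ⟨a, ha⟩ := Function.ne_iff.1 hu
  set p : Polynomial ℝ := ∑ b : Fin (2 * d + 1), Polynomial.monomial (b : ℕ) (u b)
  have hp : p ≠ 0 := fun h0 => ha (by
    have := congrArg (Polynomial.coeff · (a : ℕ)) h0
    simpa [p, Polynomial.finsetSum_coeff, Polynomial.coeff_monomial, Fin.val_inj] using this)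
  have hae : ∀ᵐ y ∂μ, y ∈ Function.support fun y => evalCoeffs u y ^ 2 := by
    filter_upwards [ae_polynomial_eval_ne_zero μ hp] with y hy
    have : p.eval y = evalCoeffs u y := by
      simp [p, evalCoeffs, Polynomial.eval_finsetSum]
    simpa [← this] using hy
  rw [pos_iff_ne_zero]
  intro h0
  have : ∀ᵐ y ∂μ, y ∉ Function.support fun y => evalCoeffs u y ^ 2 := measure_eq_zero_iff_ae_notMem.1 h0
  obtain ⟨y, h1, h2⟩ := (hae.and this).exists
  exact h2 h1

theorem runs_inventory [∀ i, IsProbabilityMeasure (E.dist i)] [∀ i, NullSingletonClass (E.dist i)]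
    (hE : ∀ i, Integrable (fun y : ℝ => y ^ (4 * d)) (E.dist i)) :
    Runs E (inventory d) (fun H => ∀ i, IsOrthonormalInventory (E.dist i) (H i))
      (inventoryCost N d) ∅ := by
  have hmul : ∀ i (u : Fin (2 * d + 1) → ℝ) (j : Fin (2 * d + 1)),
      (momentMatrix (fun k => ∫ y, y ^ (k : ℕ) ∂(E.dist i)) *ᵥ u) j =
        wMoment (E.dist i) u j := fun i u j => by
    rw [wMoment_eq_sum (hE i) u (by omega)]
    simp only [mulVec, dotProduct, momentMatrix]
    exact Finset.sum_congr rfl fun a _ => by rw [mul_comm, add_comm]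
  refine Runs.mono (.tabulate (c := (4 * d + 1) * 2 + (2 * d + 1) * gramSchmidtCost (2 * d + 1))
    fun i => Runs.mono (.bind_of (.tabulate fun k => .moment i k)
      (runs_orthonormalPolys _ ?_ le_rfl)) ?_ le_rfl subset_rfl) (fun _ h => h) ?_ subset_rfl
  · intro u hu
    refine (evalCoeffs_mul_self_pos (hE i) hu).trans_eq (Finset.sum_congr rfl fun a _ => ?_)
    rw [hmul]
  · intro H hH
    have h1 := hH.mul_single
    simp only [single_dotProduct, one_mul, hmul] at h1
    have hpos := hH.pos 0 0 rfl
    refine ⟨fun c a h => hH.apply_eq_zero c a h, fun c => hH.pos c c rfl, fun c j hj => ?_,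
      fun c => h1 c c rfl, ?_⟩
    · have := hH.single_eq_zero c ⟨j, by omega⟩ hj
      simpa only [single_dotProduct, one_mul, hmul] using this
    -- `H_0` is a constant whose square is `1`, since the total mass is one; positivity leaves the
    -- value `1`.
    · have h2 := h1 0 0 rfl
      rw [wMoment_eq_sum (hE i) _ (by simp), Finset.sum_eq_single 0] at h2
      · simp only [Fin.val_zero, add_zero, pow_zero, integral_const, probReal_univ, smul_eq_mul,
          mul_one] at h2
        nlinarith
      · intro a _ ha
        rw [hH.apply_eq_zero 0 a (Fin.pos_iff_ne_zero.2 ha), zero_mul]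
      · simp
  · simp [inventoryCost]

/-- The environment is consulted only through moments of the marginals. -/
theorem Blind.inventory : Blind (inventory d : Prog N n _) := by
  have hps : ∀ (M : Fin (4 * d + 1) → ℝ) k, Blind (orthonormalPolys M k : Prog N n _) := by
    intro M k
    induction k with
    | zero => exact .pure _
    | succ k ih =>
      refine .bind ih fun H => .bind (.of_computes fun E => .tabulate fun l => .polyInner M _ _)
        fun c => .bind (.of_computes fun E => .tabulate fun a => .bind (.sumOver fun l => .mul _ _)
        (.sub _ _)) fun v => .bind (.of_computes fun E => .polyInner M _ _) fun q =>
        .bind (.of_computes fun E => .sqrt _) fun r =>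
        .bind (.of_computes fun E => .tabulate fun a => .div _ _) fun h => .pure _
  refine .tabulate fun i => .bind (fun μ G x y => ?_) fun M => hps M _
  rw [Computes.value (.tabulate fun k => .moment i k),
    Computes.value (.tabulate fun k => .moment i k)]

end Inventory

/-! ### Lists of terms -/

section Terms

variable {N : ℕ}

open Classical in
/-- The features that occur in a list of terms. -/
noncomputable def relevantFeatures (L : List (Term N)) : Finset (Fin N) :=
  Finset.univ.filter (Relevant L)

theorem relevantFeatures_snoc (L : List (Term N)) (g : Fin N →₀ ℕ) (a : ℝ) :
    relevantFeatures (L ++ [(g, a)]) = relevantFeatures L ∪ g.support := by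
  ext i
  simp only [relevantFeatures, Relevant, Finset.mem_filter, Finset.mem_univ, true_and,
    Finset.mem_union, Finsupp.mem_support_iff, List.mem_append, List.mem_singleton]
  constructor
  · rintro ⟨u, hu | rfl, h⟩
    · exact .inl ⟨u, hu, h⟩
    · exact .inr h
  · rintro (⟨u, hu, h⟩ | h)
    · exact ⟨u, .inl hu, h⟩
    · exact ⟨_, .inr rfl, h⟩

theorem card_relevantFeatures_le (L : List (Term N)) (d : ℕ)
    (h : ∀ u ∈ L, u.1.support.card ≤ d) : (relevantFeatures L).card ≤ L.length * d := by
  classical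
  have hsub : relevantFeatures L ⊆ L.toFinset.biUnion fun u => u.1.support := by
    intro i hi
    obtain ⟨u, hu, h⟩ := (Finset.mem_filter.1 hi).2
    exact Finset.mem_biUnion.2 ⟨u, by simpa using hu, by simpa using h⟩
  calc _ ≤ _ := Finset.card_le_card hsub
    _ ≤ L.toFinset.card * d := Finset.card_biUnion_le_card_mul _ _ _ fun u hu =>
        h u (List.mem_toFinset.1 hu)
    _ ≤ L.length * d := Nat.mul_le_mul_right _ L.toFinset_card_le

theorem toPoly_append (L L' : List (Term N)) : toPoly (L ++ L') = toPoly L + toPoly L' := by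
  simp [toPoly]

theorem coeff_toPoly_eq_zero {L : List (Term N)} {g : Fin N →₀ ℕ} (h : ∀ u ∈ L, u.1 ≠ g) :
    MvPolynomial.coeff g (toPoly L) = 0 := by
  classical
  induction L with
  | nil => simp [toPoly]
  | cons u L ih =>
    have h1 := ih fun v hv => h v (by simp [hv])
    rw [← List.singleton_append, toPoly_append, MvPolynomial.coeff_add, h1]
    simp [toPoly, MvPolynomial.coeff_monomial, h u (by simp)]

theorem coeff_toPoly {L : List (Term N)} (hL : (L.map Prod.fst).Nodup) {u : Term N}
    (h : u ∈ L) : MvPolynomial.coeff u.1 (toPoly L) = u.2 := by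
  classical
  induction L with
  | nil => simp at h
  | cons v L ih =>
    rw [List.map_cons, List.nodup_cons] at hL
    rw [← List.singleton_append, toPoly_append, MvPolynomial.coeff_add]
    rcases List.mem_cons.1 h with rfl | h
    · rw [coeff_toPoly_eq_zero fun w hw he => hL.1 (List.mem_map.2 ⟨w, hw, he⟩)]
      simp [toPoly]
    · have : v.1 ≠ u.1 := fun he => hL.1 (List.mem_map.2 ⟨u, h, he.symm⟩)
      rw [ih hL.2 h]
      simp [toPoly, MvPolynomial.coeff_monomial, this]

/-- The members of `L` are different terms of `G`. -/
structure IsPartialTermList (L : List (Term N)) (G : MvPolynomial (Fin N) ℝ) : Prop where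
  nodup : (L.map Prod.fst).Nodup
  mem_support : ∀ u ∈ L, u.1 ∈ G.support
  coeff_eq : ∀ u ∈ L, MvPolynomial.coeff u.1 G = u.2

theorem IsPartialTermList.nil (G : MvPolynomial (Fin N) ℝ) : IsPartialTermList [] G :=
  ⟨by simp, by simp, by simp⟩

theorem IsPartialTermList.coeff_sub_of_notMem {L : List (Term N)} {G : MvPolynomial (Fin N) ℝ}
    {g : Fin N →₀ ℕ} (h : g ∉ L.map Prod.fst) :
    MvPolynomial.coeff g (G - toPoly L) = MvPolynomial.coeff g G := by
  rw [MvPolynomial.coeff_sub, coeff_toPoly_eq_zero, sub_zero]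
  exact fun u hu he => h (List.mem_map.2 ⟨u, hu, he⟩)

theorem IsPartialTermList.coeff_sub_of_mem {L : List (Term N)} {G : MvPolynomial (Fin N) ℝ}
    (hL : IsPartialTermList L G) {g : Fin N →₀ ℕ} (h : g ∈ L.map Prod.fst) :
    MvPolynomial.coeff g (G - toPoly L) = 0 := by
  obtain ⟨u, hu, rfl⟩ := List.mem_map.1 h
  rw [MvPolynomial.coeff_sub, coeff_toPoly hL.nodup hu, hL.coeff_eq u hu, sub_self]

theorem IsPartialTermList.mem_support_sub_iff {L : List (Term N)} {G : MvPolynomial (Fin N) ℝ}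
    (hL : IsPartialTermList L G) {g : Fin N →₀ ℕ} :
    g ∈ (G - toPoly L).support ↔ g ∈ G.support ∧ g ∉ L.map Prod.fst := by
  by_cases h : g ∈ L.map Prod.fst
  · simp only [MvPolynomial.mem_support_iff, hL.coeff_sub_of_mem h]
    tauto
  · simp only [MvPolynomial.mem_support_iff, coeff_sub_of_notMem h]
    tauto

theorem IsPartialTermList.isTermList {L : List (Term N)} {G : MvPolynomial (Fin N) ℝ}
    (hL : IsPartialTermList L G) (h : ∀ g ∈ G.support, g ∈ L.map Prod.fst) : IsTermList L G := by
  refine ⟨hL.nodup, fun g a => ⟨fun hga => ?_, fun ⟨h0, hga⟩ => ?_⟩⟩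
  · have h1 := hL.coeff_eq _ hga
    have h2 := MvPolynomial.mem_support_iff.1 (hL.mem_support _ hga)
    simp only at h1 h2
    exact ⟨h1 ▸ h2, h1⟩
  · obtain ⟨u, hu, rfl⟩ := List.mem_map.1 (h g (MvPolynomial.mem_support_iff.2 (hga ▸ h0)))
    rwa [← hga, hL.coeff_eq u hu]

/-- Counting distinct monomials. This is why the search may stop after `t` rounds without a final
negative test. -/
theorem IsPartialTermList.isTermList_of_card_le {L : List (Term N)}
    {G : MvPolynomial (Fin N) ℝ} (hL : IsPartialTermList L G) (h : G.support.card ≤ L.length) :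
    IsTermList L G := by
  classical
  refine hL.isTermList fun g hg => ?_
  have hsub : (L.map Prod.fst).toFinset ⊆ G.support := fun g hg => by
    obtain ⟨u, hu, rfl⟩ := List.mem_map.1 (List.mem_toFinset.1 hg)
    exact hL.mem_support u hu
  have := Finset.eq_of_subset_of_card_le hsub (by
    rwa [List.toFinset_card_of_nodup hL.nodup, List.length_map])
  rwa [← this, List.mem_toFinset] at hg

theorem IsTermList.toPoly_eq {L : List (Term N)} {G : MvPolynomial (Fin N) ℝ}
    (hL : IsTermList L G) : toPoly L = G := by
  ext g
  by_cases h : g ∈ L.map Prod.fst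
  · obtain ⟨u, hu, rfl⟩ := List.mem_map.1 h
    rw [coeff_toPoly hL.1 hu, ((hL.2 _ _).1 hu).2]
  · rw [coeff_toPoly_eq_zero fun u hu he => h (List.mem_map.2 ⟨u, hu, he⟩)]
    by_contra h0
    exact h (List.mem_map.2 ⟨_, (hL.2 g _).2 ⟨Ne.symm h0, rfl⟩, rfl⟩)

end Terms

/-! ### Lexicographic search -/

section Search

variable {N n d : ℕ} {E : Env N n}

/-- The powers `e` of the features in `A` are such that no two monomials of `Q` have a product with
larger powers. This holds for the powers found by lexicographic search. -/
structure IsTop (d : ℕ) (Q : MvPolynomial (Fin N) ℝ) (A : Finset (Fin N)) (e : Fin N →₀ ℕ) :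
    Prop where
  eq_zero : ∀ i ∉ A, e i = 0
  le : ∀ i, e i ≤ d
  top : ∀ g ∈ Q.support, ∀ g' ∈ Q.support, (∀ i ∈ A, 2 * e i ≤ g i + g' i) → ∀ i ∈ A, g i = e i

theorem IsTop.empty (d : ℕ) (Q : MvPolynomial (Fin N) ℝ) : IsTop d Q ∅ 0 := by
  constructor <;> simp

/-- If the powers of two monomials add up to at least `2e` on `A`, both agree with `e` there, so
both have power at most `c` in feature `i`; a sum of at least `2c` then forces equality. The value
`c` need not be attained, so the invariant is available while the search is still going down. -/
theorem IsTop.insert {Q : MvPolynomial (Fin N) ℝ} {A : Finset (Fin N)} {e : Fin N →₀ ℕ}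
    (h : IsTop d Q A e) {i : Fin N} (hi : i ∉ A) {c : ℕ} (hc : c ≤ d)
    (hle : ∀ g ∈ Q.support, (∀ j ∈ A, g j = e j) → g i ≤ c) :
    IsTop d Q (insert i A) (e.update i c) := by
  have hupd : ∀ j ∈ A, (e.update i c) j = e j := fun j hj => by
    have : j ≠ i := fun h => hi (h ▸ hj)
    rw [Finsupp.update_apply, if_neg this]
  refine ⟨fun j hj => ?_, fun j => ?_, fun g hg g' hg' hgg => ?_⟩
  · rw [Finset.mem_insert, not_or] at hj
    rw [Finsupp.update_apply, if_neg hj.1, h.eq_zero j hj.2]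
  · rw [Finsupp.update_apply]
    split_ifs
    · exact hc
    · exact h.le j
  · have hA : ∀ j ∈ A, 2 * e j ≤ g j + g' j := fun j hj => by
      rw [← hupd j hj]; exact hgg j (by simp [hj])
    have h1 := h.top g hg g' hg' hA
    have h2 := h.top g' hg' g hg fun j hj => add_comm (g j) _ ▸ hA j hj
    have h3 := hgg i (by simp)
    have h4 := hle g hg h1
    have h5 := hle g' hg' h2
    simp only [Finsupp.update_apply, if_true] at h3
    intro j hj
    rcases Finset.mem_insert.1 hj with rfl | hj
    · simp only [Finsupp.update_apply, if_true]; omega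
    · rw [hupd j hj, h1 j hj]

theorem answer_corr_two (hE : ∀ i, IsProbabilityMeasure (E.dist i))
    (hint : ∀ i, Integrable (fun y : ℝ => y ^ (4 * d)) (E.dist i))
    (h : Fin N → Fin (2 * d + 1) → ℝ) (L : List (Term N))
    (hdeg : ∀ g ∈ (E.target - toPoly L).support, ∀ i, g i ≤ d) :
    E.answer (.corr (2 * d + 1) h L 2) =
      ∑ p ∈ (E.target - toPoly L).support ×ˢ (E.target - toPoly L).support,
        (E.target - toPoly L).coeff p.1 * (E.target - toPoly L).coeff p.2 *
          ∏ i, wMoment (E.dist i) (h i) (p.1 i + p.2 i) := by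
  simp only [Env.answer, MvPolynomial.eval_eq']
  exact (integral_prod_mul_sum_sq hint h _ (fun g => (E.target - toPoly L).coeff g)
    (fun g => g) hdeg).2

theorem answer_corr_one (hE : ∀ i, IsProbabilityMeasure (E.dist i))
    (hint : ∀ i, Integrable (fun y : ℝ => y ^ (4 * d)) (E.dist i))
    (h : Fin N → Fin (2 * d + 1) → ℝ) (L : List (Term N))
    (hdeg : ∀ g ∈ (E.target - toPoly L).support, ∀ i, g i ≤ d) :
    E.answer (.corr (2 * d + 1) h L 1) =
      ∑ g ∈ (E.target - toPoly L).support, (E.target - toPoly L).coeff g *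
          ∏ i, wMoment (E.dist i) (h i) (g i) := by
  simp only [Env.answer, MvPolynomial.eval_eq', pow_one]
  exact (integral_prod_mul_sum hint h _ (fun g => (E.target - toPoly L).coeff g)
    (fun g => g) fun g hg i => (hdeg g hg i).trans (by omega)).2

theorem IsOrthonormalInventory.evalCoeffs_zero {μ : Measure ℝ}
    {H : Fin (2 * d + 1) → Fin (2 * d + 1) → ℝ} (hH : IsOrthonormalInventory μ H) (y : ℝ) :
    evalCoeffs (H 0) y = 1 := by
  rw [evalCoeffs, Finset.sum_eq_single 0]
  · simp [hH.zero_zero]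
  · intro a _ ha
    rw [hH.apply_eq_zero 0 a (Fin.pos_iff_ne_zero.2 ha), zero_mul]
  · simp

/-- Because `H_0 = 1`, the double sum is the mean square of the polynomial `R` with terms `c g ·
x^(r g)`. Injectivity of `r` excludes cancellation, so `R` is nonzero. -/
theorem integral_sum_sq_pos {μ : Fin N → Measure ℝ} [∀ i, IsProbabilityMeasure (μ i)]
    [∀ i, NullSingletonClass (μ i)] (hμ : ∀ i, Integrable (fun y : ℝ => y ^ (4 * d)) (μ i))
    {H : Inventory N d} (hH : ∀ i, IsOrthonormalInventory (μ i) (H i))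
    {T : Finset (Fin N →₀ ℕ)} {c : (Fin N →₀ ℕ) → ℝ} {r : (Fin N →₀ ℕ) → Fin N →₀ ℕ}
    (hr : ∀ g ∈ T, ∀ i, r g i ≤ d) (hinj : Set.InjOn r T) {g₀ : Fin N →₀ ℕ} (hg₀ : g₀ ∈ T)
    (hc : c g₀ ≠ 0) :
    0 < ∑ p ∈ T ×ˢ T, c p.1 * c p.2 * ∏ i, wMoment (μ i) (H i 0) (r p.1 i + r p.2 i) := by
  obtain ⟨h1, h2⟩ := integral_prod_mul_sum_sq hμ (fun i => H i 0) T c (fun g => r g) hr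
  rw [← h2]
  simp only [fun i => (hH i).evalCoeffs_zero, Finset.prod_const_one, one_mul] at h1 ⊢
  rw [integral_pos_iff_support_of_nonneg (fun x => sq_nonneg _) h1]
  set R : MvPolynomial (Fin N) ℝ := ∑ g ∈ T, MvPolynomial.monomial (r g) (c g)
  have hR : R ≠ 0 := fun h0 => hc (by
    have := congrArg (MvPolynomial.coeff (r g₀)) h0
    classical
    simp only [R, MvPolynomial.coeff_sum, MvPolynomial.coeff_monomial,
      MvPolynomial.coeff_zero] at this
    rw [Finset.sum_eq_single g₀] at this
    · simpa using this
    · exact fun g hg hne => if_neg fun h => hne (hinj hg hg₀ h)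
    · exact fun h => absurd hg₀ h)
  have hev : ∀ x, MvPolynomial.eval x R = ∑ g ∈ T, c g * ∏ i, x i ^ r g i := fun x => by
    simp only [R, map_sum, MvPolynomial.eval_monomial]
    exact Finset.sum_congr rfl fun g _ => by rw [Finsupp.prod_fintype _ _ fun i => pow_zero _]
  have hae : ∀ᵐ x ∂Measure.pi μ,
      x ∈ Function.support fun x : Fin N → ℝ => (∑ g ∈ T, c g * ∏ i, x i ^ r g i) ^ 2 := by
    filter_upwards [ae_mvPolynomial_eval_ne_zero μ hR] with x hx
    simpa [← hev] using hx
  rw [pos_iff_ne_zero]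
  intro h0
  obtain ⟨y, h1, h2⟩ := (hae.and (measure_eq_zero_iff_ae_notMem.1 h0)).exists
  exact h2 h1

theorem ofNat_two_mul {e : ℕ} (h : e ≤ d) :
    ((Fin.ofNat (2 * d + 1) (2 * e) : Fin (2 * d + 1)) : ℕ) = 2 * e :=
  Nat.mod_eq_of_lt (by omega)

/-- The assumptions on the environment that make the search work. -/
structure Env.IsRegular (E : Env N n) (d : ℕ) : Prop where
  prob : ∀ i, IsProbabilityMeasure (E.dist i)
  atomless : ∀ i, NullSingletonClass (E.dist i)
  integrable : ∀ i, Integrable (fun y : ℝ => y ^ (4 * d)) (E.dist i)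

open Classical in
-- Expand the square over pairs of monomials. By `IsTop`, a pair that does not agree with `e` on `A`
-- falls below `2e` in some feature of `A`, where its factor vanishes. The other pairs share a
-- positive factor `B` from `A`, and what is left is a mean square in the features outside `A`.
theorem test_value (hE : E.IsRegular d) {H : Inventory N d}
    (hH : ∀ i, IsOrthonormalInventory (E.dist i) (H i)) {L : List (Term N)}
    (hdeg : ∀ g ∈ (E.target - toPoly L).support, ∀ i, g i ≤ d) {A : Finset (Fin N)}
    {e : Fin N →₀ ℕ} (he : IsTop d (E.target - toPoly L) A e) :
    ((test H L e).run E).value =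
      decide (∃ g ∈ (E.target - toPoly L).support, ∀ i ∈ A, g i = e i) := by
  have := hE.prob
  have := hE.atomless
  rw [test, run_bind_value, run_exec, run_less]
  simp only [decide_eq_decide]
  rw [answer_corr_two hE.prob hE.integrable _ L hdeg]
  set Q := E.target - toPoly L
  set T := Q.support.filter fun g => ∀ i ∈ A, g i = e i
  set κ : Fin N → Fin (2 * d + 1) := fun i => Fin.ofNat (2 * d + 1) (2 * e i)
  have hκ : ∀ i, (κ i : ℕ) = 2 * e i := fun i => ofNat_two_mul (he.le i)
  have hκ0 : ∀ i ∉ A, κ i = 0 := fun i hi => Fin.ext (by rw [hκ, he.eq_zero i hi]; rfl)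
  -- `r` strips the powers on `A`, which all monomials of `T` share; hence it is injective on `T`.
  -- Outside `A` the test uses `H_0 = 1`.
  set r : (Fin N →₀ ℕ) → Fin N →₀ ℕ := fun g => g.filter (· ∉ A)
  set B := ∏ i ∈ A, wMoment (E.dist i) (H i (κ i)) (2 * e i)
  -- Each factor is the inverse of a positive leading coefficient.
  have hB : 0 < B := Finset.prod_pos fun i _ => by
    have h1 := (hH i).mul_wMoment (κ i)
    have h2 := (hH i).pos (κ i)
    rw [hκ] at h1
    exact pos_of_mul_pos_right (by rw [h1]; exact one_pos) h2.le
  have hM0 : ∀ i, wMoment (E.dist i) (H i 0) 0 = 1 := fun i => by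
    have := (hH i).mul_wMoment 0
    rwa [(hH i).zero_zero, one_mul] at this
  have hsum : ∑ p ∈ Q.support ×ˢ Q.support, Q.coeff p.1 * Q.coeff p.2 *
        ∏ i, wMoment (E.dist i) (H i (κ i)) (p.1 i + p.2 i) =
      B * ∑ p ∈ T ×ˢ T, Q.coeff p.1 * Q.coeff p.2 *
        ∏ i, wMoment (E.dist i) (H i 0) (r p.1 i + r p.2 i) := by
    rw [Finset.mul_sum]
    refine (Finset.sum_subset_zero_on_sdiff (Finset.product_subset_product (Finset.filter_subset _ _)
      (Finset.filter_subset _ _)) (fun p hp => ?_) fun p hp => ?_).symm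
    · obtain ⟨h1, h2⟩ := Finset.mem_sdiff.1 hp
      obtain ⟨hp1, hp2⟩ := Finset.mem_product.1 h1
      obtain ⟨i, hi, hlt⟩ : ∃ i ∈ A, p.1 i + p.2 i < 2 * e i := by
        by_contra! hcon
        refine h2 (Finset.mem_product.2 ⟨?_, ?_⟩)
        · exact Finset.mem_filter.2 ⟨hp1, he.top _ hp1 _ hp2 hcon⟩
        · exact Finset.mem_filter.2 ⟨hp2, he.top _ hp2 _ hp1 fun i hi =>
            add_comm (p.1 i) _ ▸ hcon i hi⟩
      rw [Finset.prod_eq_zero (Finset.mem_univ i), mul_zero]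
      exact (hH i).wMoment_eq_zero _ _ (by rw [hκ]; exact hlt)
    · obtain ⟨hp1, hp2⟩ := Finset.mem_product.1 hp
      have h1 := (Finset.mem_filter.1 hp1).2
      have h2 := (Finset.mem_filter.1 hp2).2
      have hprod : ∏ i, wMoment (E.dist i) (H i (κ i)) (p.1 i + p.2 i) =
          B * ∏ i, wMoment (E.dist i) (H i 0) (r p.1 i + r p.2 i) := by
        rw [← Finset.prod_mul_prod_compl A, ← Finset.prod_mul_prod_compl A fun i =>
          wMoment (E.dist i) (H i 0) (r p.1 i + r p.2 i)]
        rw [Finset.prod_eq_one (s := A) (f := fun i =>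
          wMoment (E.dist i) (H i 0) (r p.1 i + r p.2 i)), one_mul]
        · refine congrArg₂ _ (Finset.prod_congr rfl fun i hi => ?_)
            (Finset.prod_congr rfl fun i hi => ?_)
          · exact congrArg _ (by rw [h1 i hi, h2 i hi, two_mul])
          · have hi' := Finset.mem_compl.1 hi
            simp [r, hκ0 i hi', hi']
        · intro i hi
          simp [r, hi, hM0]
      rw [hprod]
      ring
  rw [hsum, mul_pos_iff_of_pos_left hB]
  constructor
  · intro hpos
    obtain ⟨p, hp, -⟩ := Finset.exists_ne_zero_of_sum_ne_zero hpos.ne'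
    obtain ⟨h1, h2⟩ := Finset.mem_filter.1 (Finset.mem_product.1 hp).1
    exact ⟨p.1, h1, h2⟩
  · rintro ⟨g₀, hg₀, hA⟩
    refine integral_sum_sq_pos hE.integrable hH (fun g hg i => ?_) ?_
      (Finset.mem_filter.2 ⟨hg₀, hA⟩) (MvPolynomial.mem_support_iff.1 hg₀)
    · have := hdeg g (Finset.mem_filter.1 hg).1 i
      by_cases hi : i ∈ A <;> simp [r, hi, this]
    · intro g hg g' hg' hgg
      have h1 := (Finset.mem_filter.1 hg).2
      have h2 := (Finset.mem_filter.1 hg').2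
      ext i
      by_cases hi : i ∈ A
      · rw [h1 i hi, h2 i hi]
      · have := DFunLike.congr_fun hgg i
        simpa [r, hi] using this

/-- A monomial with a smaller power than `g` in some feature is annihilated there, and by `htop`
every other monomial differing from `g` is excluded. The leading coefficients normalise the moments
of `g` itself to `1`. -/
theorem coefficient_value (hE : E.IsRegular d) {H : Inventory N d}
    (hH : ∀ i, IsOrthonormalInventory (E.dist i) (H i)) {L : List (Term N)}
    (hdeg : ∀ g ∈ (E.target - toPoly L).support, ∀ i, g i ≤ d) {g : Fin N →₀ ℕ}
    (hg : ∀ i, g i ≤ d)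
    (htop : ∀ g' ∈ (E.target - toPoly L).support, (∀ i, g i ≤ g' i) → g' = g) :
    ((coefficient H L g).run E).value = (E.target - toPoly L).coeff g := by
  have := hE.prob
  rw [coefficient, run_bind_value,
    Computes.value (.tabulate fun i => .tabulate fun a => .mul _ _), run_exec]
  simp only
  rw [answer_corr_one hE.prob hE.integrable _ L hdeg]
  set Q := E.target - toPoly L
  set κ : Fin N → Fin (2 * d + 1) := fun i => Fin.ofNat (2 * d + 1) (g i)
  have hκ : ∀ i, (κ i : ℕ) = g i := fun i => Nat.mod_eq_of_lt (by have := hg i; omega)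
  have hw : ∀ i j, wMoment (E.dist i) (fun a => H i (κ i) (κ i) * H i (κ i) a) j =
      H i (κ i) (κ i) * wMoment (E.dist i) (H i (κ i)) j := fun i j => by
    simp only [wMoment, evalCoeffs, mul_assoc, ← Finset.mul_sum]
    rw [integral_const_mul]
  have hz : ∀ g' ∈ Q.support, g' ≠ g → Q.coeff g' * ∏ i, wMoment (E.dist i)
      (fun a => H i (κ i) (κ i) * H i (κ i) a) (g' i) = 0 := fun g' hg' hne => by
    obtain ⟨i, hi⟩ : ∃ i, g' i < g i := by
      by_contra! hcon
      exact hne (htop g' hg' hcon)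
    rw [Finset.prod_eq_zero (Finset.mem_univ i), mul_zero]
    rw [hw, (hH i).wMoment_eq_zero _ _ (by rw [hκ]; exact hi), mul_zero]
  rw [Finset.sum_eq_single g hz]
  · rw [Finset.prod_eq_one, mul_one]
    intro i _
    rw [hw, ← hκ i, (hH i).mul_wMoment]
  · intro h
    rw [MvPolynomial.notMem_support_iff.1 h, zero_mul]

/-- Descent on the bound `c`: `hle` makes the test at `c` exact, and a negative test excludes
equality and so lowers the bound by one. Below `0` no matching monomial is left. -/
theorem topPower_value (hE : E.IsRegular d) {H : Inventory N d}
    (hH : ∀ i, IsOrthonormalInventory (E.dist i) (H i)) {L : List (Term N)}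
    (hdeg : ∀ g ∈ (E.target - toPoly L).support, ∀ i, g i ≤ d) {A : Finset (Fin N)}
    {e : Fin N →₀ ℕ} (he : IsTop d (E.target - toPoly L) A e) {i : Fin N} (hi : i ∉ A) {c : ℕ}
    (hc : c ≤ d)
    (hle : ∀ g ∈ (E.target - toPoly L).support, (∀ j ∈ A, g j = e j) → g i ≤ c) :
    (((topPower H L e i c).run E).value = none ∧
      ∀ g ∈ (E.target - toPoly L).support, ¬ ∀ j ∈ A, g j = e j) ∨
    ∃ b, ((topPower H L e i c).run E).value = some b ∧
      IsTop d (E.target - toPoly L) (insert i A) (e.update i b) ∧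
      ∃ g ∈ (E.target - toPoly L).support, ∀ j ∈ insert i A, g j = (e.update i b) j := by
  classical
  have htop := he.insert hi hc hle
  have htest := test_value hE hH hdeg htop
  have hagree : ∀ g : Fin N →₀ ℕ, (∀ j ∈ A, g j = e j) → g i = c →
      ∀ j ∈ insert i A, g j = (e.update i c) j := fun g hg hgi j hj => by
    rw [Finsupp.update_apply]
    split_ifs with h
    · rw [h, hgi]
    · exact hg j ((Finset.mem_insert.1 hj).resolve_left h)
  induction c with
  | zero =>
    rw [topPower, run_bind_value, htest, run_pure]
    by_cases h : ∃ g ∈ (E.target - toPoly L).support, ∀ j ∈ insert i A, g j = (e.update i 0) j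
    · exact .inr ⟨0, by simp only [h, decide_true, if_true], htop, h⟩
    · refine .inl ⟨by simp only [h, decide_false, Bool.false_eq_true, if_false], ?_⟩
      exact fun g hg hgA => h ⟨g, hg, hagree g hgA (Nat.le_zero.1 (hle g hg hgA))⟩
  | succ c ih =>
    rw [topPower, run_bind_value, htest]
    by_cases h : ∃ g ∈ (E.target - toPoly L).support,
        ∀ j ∈ insert i A, g j = (e.update i (c + 1)) j
    · exact .inr ⟨c + 1, by simp only [h, decide_true, if_true, run_pure], htop, h⟩
    · simp only [h, decide_false, Bool.false_eq_true, if_false]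
      have hle' : ∀ g ∈ (E.target - toPoly L).support, (∀ j ∈ A, g j = e j) → g i ≤ c :=
        fun g hg hgA => by
          have h1 := hle g hg hgA
          by_contra! h2
          exact h ⟨g, hg, hagree g hgA (by omega)⟩
      have htop' := he.insert hi (by omega) hle'
      refine ih (by omega) hle' htop' (test_value hE hH hdeg htop') fun g hg hgi j hj => ?_
      rw [Finsupp.update_apply]
      split_ifs with h
      · rw [h, hgi]
      · exact hg j ((Finset.mem_insert.1 hj).resolve_left h)

/-- Once a power has been found, a monomial with the powers so far exists, so no later feature can
fail: `none` arises only at the first feature. `hne` is needed because a search over no features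
returns powers even if no monomial is left. -/
theorem lexSearch_value (hE : E.IsRegular d) {H : Inventory N d}
    (hH : ∀ i, IsOrthonormalInventory (E.dist i) (H i)) {L : List (Term N)}
    (hdeg : ∀ g ∈ (E.target - toPoly L).support, ∀ i, g i ≤ d) {A : Finset (Fin N)}
    {e : Fin N →₀ ℕ} (he : IsTop d (E.target - toPoly L) A e) {I : List (Fin N)} (hI : I.Nodup)
    (hIA : ∀ i ∈ I, i ∉ A)
    (hne : I ≠ [] ∨ ∃ g ∈ (E.target - toPoly L).support, ∀ j ∈ A, g j = e j) :
    (((lexSearch H L I e).run E).value = none ∧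
      ∀ g ∈ (E.target - toPoly L).support, ¬ ∀ j ∈ A, g j = e j) ∨
    ∃ e', ((lexSearch H L I e).run E).value = some e' ∧
      IsTop d (E.target - toPoly L) (A ∪ I.toFinset) e' ∧
      ∃ g ∈ (E.target - toPoly L).support, ∀ j ∈ A ∪ I.toFinset, g j = e' j := by
  induction I generalizing A e with
  | nil => exact .inr ⟨e, rfl, by simpa using he, by simpa using hne⟩
  | cons i I ih =>
    rw [List.nodup_cons] at hI
    rcases topPower_value hE hH hdeg he (hIA i (by simp)) le_rfl fun g hg _ => hdeg g hg i with
      ⟨h1, h2⟩ | ⟨b, h1, h2, h3⟩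
    · refine .inl ⟨?_, h2⟩
      rw [lexSearch, run_bind_value, h1]
      rfl
    · have hset : insert i A ∪ I.toFinset = A ∪ (i :: I).toFinset := by
        ext j; simp
      rw [lexSearch, run_bind_value, h1]
      have := ih h2 hI.2 (fun j hj => by
        rw [Finset.mem_insert, not_or]
        exact ⟨fun h => hI.1 (h ▸ hj), hIA j (by simp [hj])⟩) (.inr h3)
      rw [hset] at this
      refine this.resolve_left ?_ |> .inr
      rintro ⟨-, h⟩
      obtain ⟨g, hg, hgA⟩ := h3
      exact h g hg hgA

/-- If `lift` determines the monomials of the target by the powers of the features in `I`, then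
all of them are extracted. -/
theorem extract_value (hE : E.IsRegular d) {H : Inventory N d}
    (hH : ∀ i, IsOrthonormalInventory (E.dist i) (H i))
    (hdeg : ∀ g ∈ E.target.support, ∀ i, g i ≤ d) {I : List (Fin N)} (hI : I.Nodup)
    (hne : I ≠ []) {lift : (Fin N →₀ ℕ) → Prog N n (Option (Fin N →₀ ℕ))}
    (hlift : ∀ e : Fin N →₀ ℕ, (∀ i ∉ I, e i = 0) → ∀ g ∈ E.target.support,
      (∀ i ∈ I, g i = e i) → ((lift e).run E).value = some g)
    {r : ℕ} {L : List (Term N)} (hL : IsPartialTermList L E.target)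
    (hr : E.target.support.card ≤ L.length + r) :
    ∃ L', ((extract H I lift r L).run E).value = some L' ∧ IsTermList L' E.target := by
  induction r generalizing L with
  | zero => exact ⟨L, rfl, hL.isTermList_of_card_le hr⟩
  | succ r ih =>
    have hdeg' : ∀ g ∈ (E.target - toPoly L).support, ∀ i, g i ≤ d := fun g hg =>
      hdeg g (hL.mem_support_sub_iff.1 hg).1
    rw [extract, run_bind_value]
    rcases lexSearch_value hE hH hdeg' (.empty d _) hI (by simp) (.inl hne) with
      ⟨h1, h2⟩ | ⟨e, h1, h2, g, hg, h3⟩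
    · rw [h1]
      refine ⟨L, rfl, hL.isTermList fun g hg => ?_⟩
      -- The search started with no constraints, so any remaining monomial would match vacuously.
      by_contra hgL
      exact h2 g (hL.mem_support_sub_iff.2 ⟨hg, hgL⟩) (by simp)
    · rw [h1]
      simp only [Finset.empty_union, List.mem_toFinset] at h2 h3
      have hgG := (hL.mem_support_sub_iff.1 hg).1
      have he0 : ∀ i ∉ I, e i = 0 := fun i hi => h2.eq_zero i (by simpa using hi)
      have hl := hlift e he0 g hgG h3
      have hcoeff : ((coefficient H L g).run E).value = E.target.coeff g := by
        rw [coefficient_value hE hH hdeg' (hdeg' g hg),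
          IsPartialTermList.coeff_sub_of_notMem (hL.mem_support_sub_iff.1 hg).2]
        -- A monomial that dominates `g` has powers at least `e` on `I`, hence equal to `e` by
        -- `IsTop`; both monomials are then the lift of `e` and coincide.
        intro g' hg' hle
        have hg'I := h2.top g' hg' g' hg' fun i hi => by
          have := hle i
          rw [h3 i (by simpa using hi)] at this
          omega
        have hl' := hlift e he0 g' (hL.mem_support_sub_iff.1 hg').1 fun i hi =>
          hg'I i (by simpa using hi)
        exact Option.some_injective _ (hl'.symm.trans hl)
      simp only
      rw [run_bind_value, hl]
      simp only
      rw [run_bind_value, hcoeff]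
      refine ih ⟨?_, ?_, ?_⟩ (by simp; omega)
      · rw [List.map_append, List.map_singleton]
        refine List.Nodup.append hL.nodup (by simp) ?_
        rw [List.disjoint_singleton]
        exact (hL.mem_support_sub_iff.1 hg).2
      · intro u hu
        rcases List.mem_append.1 hu with hu | hu
        · exact hL.mem_support u hu
        · rw [List.mem_singleton.1 hu]; exact hgG
      · intro u hu
        rcases List.mem_append.1 hu with hu | hu
        · exact hL.coeff_eq u hu
        · rw [List.mem_singleton.1 hu]

/-! #### Costs of the search -/

/-- The number of steps of a test with a list of `l` terms. -/
def testCost {R : Type*} [CommSemiring R] (N d l : R) : R :=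
  N * (2 * d + 1) + (N + 1) * l + 2

theorem corr_cells_subset {w : ℕ} {h : Fin N → Fin w → ℝ} (L : List (Term N)) (p : ℕ)
    {A : Finset (Fin N)} (hA : ∀ i ∉ A, ∀ k : Fin w, (k : ℕ) ≠ 0 → h i k = 0) :
    (Instr.corr w h L p : Instr N n).cells ⊆ trainingCells n (A ∪ relevantFeatures L) := by
  classical
  refine Finset.product_subset_product_right fun i hi => ?_
  rcases (Finset.mem_filter.1 hi).2 with ⟨k, hk, h⟩ | h
  · exact Finset.mem_union_left _ (by_contra fun hi => h (hA i hi k hk))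
  · exact Finset.mem_union_right _ (by simp [relevantFeatures, h])

/-- Features with power `0` enter through a constant polynomial and need no evaluation; the saving
over evaluating all `N` features depends on this. -/
theorem runs_test {H : Inventory N d} (hH : ∀ i a, a ≠ 0 → H i 0 a = 0) (L : List (Term N))
    (e : Fin N →₀ ℕ) :
    Runs E (test H L e) (fun _ => True) (testCost N d L.length)
      (trainingCells n (e.support ∪ relevantFeatures L)) := by
  refine ⟨trivial, ?_, ?_⟩
  · rw [test, run_bind_steps, run_exec, run_less]
    simp [Instr.cost, testCost]
  · rw [test, run_bind_cells, run_exec, run_less]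
    simp only [Finset.union_empty]
    refine corr_cells_subset L 2 fun i hi k hk => ?_
    rw [Finsupp.notMem_support_iff.1 hi]
    exact hH i k fun h => hk (by simp [h])

theorem runs_topPower {H : Inventory N d} (hH : ∀ i a, a ≠ 0 → H i 0 a = 0) (L : List (Term N))
    (e : Fin N →₀ ℕ) (i : Fin N) (c : ℕ) :
    Runs E (topPower H L e i c) (fun _ => True) ((c + 1) * testCost N d L.length)
      (trainingCells n (insert i e.support ∪ relevantFeatures L)) := by
  have htest : ∀ b, Runs E (test H L (e.update i b)) (fun _ => True) (testCost N d L.length)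
      (trainingCells n (insert i e.support ∪ relevantFeatures L)) := fun b =>
    (runs_test hH L _).mono (fun _ h => h) le_rfl <| trainingCells_mono <|
      Finset.union_subset_union_left fun j hj => by
        rw [Finsupp.mem_support_iff, Finsupp.update_apply] at hj
        rw [Finset.mem_insert, Finsupp.mem_support_iff]
        split_ifs at hj with h
        · exact .inl h
        · exact .inr hj
  induction c with
  | zero =>
    exact ((htest 0).bind fun b _ => Runs.pure trivial 0 _).mono (fun _ h => h) (by simp) subset_rfl
  | succ c ih =>
    refine Runs.mono (.bind (c' := (c + 1) * testCost N d L.length) (htest (c + 1)) fun b _ => ?_)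
      (fun _ h => h) (le_of_eq (by ring)) subset_rfl
    split_ifs
    · exact .pure trivial _ _
    · exact ih

theorem runs_lexSearch {H : Inventory N d} (hH : ∀ i a, a ≠ 0 → H i 0 a = 0) (L : List (Term N))
    (I : List (Fin N)) (e : Fin N →₀ ℕ) :
    Runs E (lexSearch H L I e) (fun _ => True) (I.length * ((d + 1) * testCost N d L.length))
      (trainingCells n (e.support ∪ I.toFinset ∪ relevantFeatures L)) := by
  induction I generalizing e with
  | nil => exact .pure trivial _ _
  | cons i I ih =>
    refine Runs.mono (.bind ((runs_topPower hH L e i d).mono (fun _ h => h) le_rfl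
      (trainingCells_mono fun j hj => ?_)) fun o _ => ?_) (fun _ h => h)
      (le_of_eq (by rw [List.length_cons]; ring :
        (d + 1) * testCost N d L.length + I.length * ((d + 1) * testCost N d L.length) = _))
      subset_rfl
    · simp only [Finset.mem_union, Finset.mem_insert, List.toFinset_cons] at hj ⊢
      tauto
    · cases o with
      | none => exact .pure trivial _ _
      | some c =>
        refine (ih _).mono (fun _ h => h) le_rfl (trainingCells_mono fun j hj => ?_)
        simp only [Finset.mem_union, Finset.mem_insert, List.toFinset_cons,
          Finsupp.mem_support_iff, Finsupp.update_apply] at hj ⊢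
        by_cases h : j = i
        · tauto
        · rw [if_neg h] at hj; tauto

/-- The number of steps of `coefficient` with a list of `l` terms. -/
def coefficientCost {R : Type*} [CommSemiring R] (N d l : R) : R :=
  N * ((2 * d + 1) * 2 + 1) + (N * (2 * d + 1) + (N + 1) * l + 1)

theorem runs_coefficient {H : Inventory N d} (hH : ∀ i a, a ≠ 0 → H i 0 a = 0)
    (L : List (Term N)) (g : Fin N →₀ ℕ) :
    Runs E (coefficient H L g) (fun _ => True) (coefficientCost N d L.length)
      (trainingCells n (g.support ∪ relevantFeatures L)) := by
  refine Runs.mono (.bind_of (.tabulate fun i => .tabulate fun a => .mul _ _)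
    (.exec ?_)) (fun _ h => h) ?_ subset_rfl
  · refine corr_cells_subset L 1 fun i hi k hk => mul_eq_zero_of_right _ ?_
    rw [Finsupp.notMem_support_iff.1 hi]
    exact hH i k fun h => hk (by simp [h])
  · simp [coefficientCost, Instr.cost]

/-- A bound for the number of steps of `extract` with `r` rounds over `s` features, if `lift` needs
`c` steps and the result has at most `l` terms. -/
def extractCost {R : Type*} [CommSemiring R] (N d l s c r : R) : R :=
  r * (s * ((d + 1) * testCost N d l) + (c + coefficientCost N d l))

/-- Beyond `I` and the features of `L`, only features of newly extracted terms are evaluated, at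
most `D` new ones per round; which ones depends on the run, hence the existential `B`. The target is
arbitrary, so the bounds also cover runs that produce wrong terms. -/
theorem runs_extract {H : Inventory N d} (hH : ∀ i a, a ≠ 0 → H i 0 a = 0) (I : List (Fin N))
    {lift : (Fin N →₀ ℕ) → Prog N n (Option (Fin N →₀ ℕ))} {P : (Fin N →₀ ℕ) → Prop} {D c l : ℕ}
    (hlift : ∀ e, Runs E (lift e) (fun o => ∀ g, o = some g → P g) c ∅)
    (hP : ∀ g, P g → g.support.card ≤ D) (r : ℕ) (L : List (Term N)) (hl : L.length + r ≤ l) :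
    ∃ B : Finset (Fin N), B.card ≤ r * D ∧
      Runs E (extract H I lift r L)
        (fun o => ∀ L', o = some L' → L'.length ≤ L.length + r ∧ ∀ u ∈ L', u ∈ L ∨ P u.1)
        (extractCost N d l I.length c r)
        (trainingCells n (I.toFinset ∪ relevantFeatures L ∪ B)) := by
  induction r generalizing L with
  | zero =>
    refine ⟨∅, by simp, .pure (fun L' h => ?_) _ _⟩
    cases h
    exact ⟨le_rfl, fun u hu => .inl hu⟩
  | succ r ih =>
    have hl' : L.length ≤ l := by omega
    have htl : testCost N d L.length ≤ testCost N d l := by unfold testCost; gcongr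
    have hcl : coefficientCost N d L.length ≤ coefficientCost N d l := by
      unfold coefficientCost; gcongr
    have hcost : I.length * ((d + 1) * testCost N d L.length) + (c +
        (coefficientCost N d L.length + extractCost N d l I.length c r)) ≤
        extractCost N d l I.length c (r + 1) := by
      have : I.length * ((d + 1) * testCost N d L.length) ≤
        I.length * ((d + 1) * testCost N d l) := by gcongr
      simp only [extractCost] at this hcl ⊢
      linarith
    have hlex : ∀ B : Finset (Fin N), Runs E (lexSearch H L I 0) (fun _ => True)
        (I.length * ((d + 1) * testCost N d L.length))
        (trainingCells n (I.toFinset ∪ relevantFeatures L ∪ B)) := fun B =>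
      (runs_lexSearch hH L I 0).mono (fun _ h => h) le_rfl
        (trainingCells_mono (by
          rw [Finsupp.support_zero, Finset.empty_union]; exact Finset.subset_union_left))
    rcases ho : ((lexSearch H L I 0).run E).value with - | e
    · refine ⟨∅, by simp, Runs.mono (.bind_value (hlex ∅) ?_) (fun _ h => h) hcost subset_rfl⟩
      rw [ho]
      refine .pure (fun L' h => ?_) _ _
      cases h
      exact ⟨by omega, fun u hu => .inl hu⟩
    rcases ho' : ((lift e).run E).value with - | g
    · refine ⟨∅, by simp, Runs.mono (.bind_value (hlex ∅) ?_) (fun _ h => h) hcost subset_rfl⟩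
      rw [ho]
      refine .bind_value ((hlift e).mono (fun _ h => h) le_rfl (Finset.empty_subset _)) ?_
      rw [ho']
      exact .pure (fun L' h => by cases h) _ _
    · have hg : P g := (hlift e).value g ho'
      set a := ((coefficient H L g).run E).value
      obtain ⟨B, hB, hrun⟩ := ih (L ++ [(g, a)]) (by simp; omega)
      refine ⟨g.support ∪ B, ?_, Runs.mono (.bind_value (hlex _) ?_) (fun _ h => h) hcost
        subset_rfl⟩
      · have := Finset.card_union_le g.support B
        have := hP g hg
        linarith
      rw [ho]
      refine .bind_value ((hlift e).mono (fun _ h => h) le_rfl (Finset.empty_subset _)) ?_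
      rw [ho']
      refine .bind_value ((runs_coefficient hH L g).mono (fun _ h => h) le_rfl
        (trainingCells_mono fun j hj => ?_)) (hrun.mono ?_ le_rfl (trainingCells_mono fun j hj => ?_))
      · simp only [Finset.mem_union] at hj ⊢
        tauto
      · intro o ho L' hL'
        obtain ⟨h1, h2⟩ := ho L' hL'
        simp only [List.length_append, List.length_singleton] at h1
        refine ⟨by omega, fun u hu => ?_⟩
        rcases h2 u hu with h | h
        · rcases List.mem_append.1 h with h | h
          · exact .inl h
          · rw [List.mem_singleton.1 h]; exact .inr hg
        · exact .inr h
      · rw [relevantFeatures_snoc] at hj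
        simp only [Finset.mem_union] at hj ⊢
        tauto

theorem Blind.corr {w : ℕ} (h : Fin N → Fin w → ℝ) (L : List (Term N)) (p : ℕ) :
    Blind (exec (.corr w h L p) : Prog N n ℝ) := fun μ G x y => by
  simp [run_exec, Env.answer]

theorem Blind.test (H : Inventory N d) (L : List (Term N)) (e : Fin N →₀ ℕ) :
    Blind (test H L e : Prog N n Bool) := .bind (.corr _ _ _) fun _ => .less _ _

theorem Blind.topPower (H : Inventory N d) (L : List (Term N)) (e : Fin N →₀ ℕ) (i : Fin N)
    (c : ℕ) : Blind (topPower H L e i c : Prog N n _) := by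
  induction c with
  | zero => exact .bind (.test _ _ _) fun _ => .pure _
  | succ c ih =>
    refine .bind (.test _ _ _) fun b => ?_
    split_ifs
    · exact .pure _
    · exact ih

theorem Blind.lexSearch (H : Inventory N d) (L : List (Term N)) (I : List (Fin N))
    (e : Fin N →₀ ℕ) : Blind (lexSearch H L I e : Prog N n _) := by
  induction I generalizing e with
  | nil => exact .pure _
  | cons i I ih =>
    refine .bind (.topPower _ _ _ _ _) fun o => ?_
    cases o with
    | none => exact .pure _
    | some c => exact ih _

theorem Blind.extract (H : Inventory N d) (I : List (Fin N))
    {lift : (Fin N →₀ ℕ) → Prog N n (Option (Fin N →₀ ℕ))} (hlift : ∀ e, Blind (lift e)) (r : ℕ)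
    (L : List (Term N)) : Blind (extract H I lift r L) := by
  induction r generalizing L with
  | zero => exact .pure _
  | succ r ih =>
    refine .bind (.lexSearch _ _ _ _) fun o => ?_
    cases o with
    | none => exact .pure _
    | some e =>
      refine .bind (hlift e) fun o => ?_
      cases o with
      | none => exact .pure _
      | some g =>
        exact .bind (.bind (.of_computes fun E => .tabulate fun i => .tabulate fun a => .mul _ _)
          fun h => .corr _ _ _) fun a => ih _

end Search

/-! ### Learning from the representation -/

section Lift

variable {N n d : ℕ} {E : Env N n}

theorem runs_asPower (y : ℝ) (c : ℕ) :
    Runs E (asPower y c)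
      (fun o => (∀ b, o = some b → y = (b : ℝ)) ∧ ∀ b ≤ c, y = (b : ℝ) → o = some b)
      ((c + 1) * 2) ∅ := by
  classical
  induction c with
  | zero =>
    refine .bind_of (c' := 0) (.same _ _) (.pure ?_ _ _)
    by_cases h : y = 0
    · simp only [h, decide_true, if_true]
      exact ⟨fun b hb => by cases hb; simp, fun b hb _ => by rw [Nat.le_zero.1 hb]⟩
    · simp only [h, decide_false, Bool.false_eq_true, if_false]
      exact ⟨fun b hb => by simp at hb, fun b hb hy =>
        absurd (by rw [hy, Nat.le_zero.1 hb, Nat.cast_zero]) h⟩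
  | succ c ih =>
    refine Runs.mono (.bind_of (c' := (c + 1) * 2) (.same _ _) ?_) (fun _ h => h)
      (le_of_eq (by ring)) subset_rfl
    by_cases h : y = ((c + 1 : ℕ) : ℝ)
    · simp only [h, decide_true, if_true]
      refine .pure ⟨fun b hb => by cases hb; rfl, fun b _ hb => ?_⟩ _ _
      rw [Nat.cast_injective hb]
    · simp only [h, decide_false, Bool.false_eq_true, if_false]
      refine ih.mono (fun o ho => ⟨ho.1, fun b hb hy => ho.2 b ?_ hy⟩) le_rfl subset_rfl
      refine Nat.lt_succ_iff.1 (lt_of_le_of_ne hb fun hbc => h ?_)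
      rw [hy, hbc]

/-- A bound for the number of steps of `liftPowers` for a representation with `f` columns. -/
def liftCost {R : Type*} [CommSemiring R] (N d f : R) : R :=
  solveCost f f + (N * (f * 2 + 1) + (N * ((d + 1) * 2 + 1) + N))

/-- Soundness is unconditional, so that degree and column space are controlled even for targets that
are not covered. For completeness, the solution `w` and the coordinates `w₀` of `g` agree on the
rows `I`; as these have the kernel of the whole matrix, `F w = F w₀`. -/
theorem runs_liftPowers (F : Rep N) (I : List (Fin N)) (hI : I.length ≤ F.length)
    (e : Fin N →₀ ℕ) :
    Runs E (liftPowers d F I e) (fun o =>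
      (∀ g, o = some g → vec g ∈ colSpan F ∧ ∑ i, g i ≤ d) ∧
      ((∀ v : Fin F.length → ℝ, (∀ i ∈ I, row F i ⬝ᵥ v = 0) → ∀ i, row F i ⬝ᵥ v = 0) →
        ∀ g, vec g ∈ colSpan F → ∑ i, g i ≤ d → (∀ i ∈ I, g i = e i) → o = some g))
      (liftCost N d F.length) ∅ := by
  classical
  refine Runs.mono (.bind (c' := N * (F.length * 2 + 1) + (N * ((d + 1) * 2 + 1) + N))
    (runs_solve _) fun w hw => .bind_of (.tabulate fun i => .sumOver fun l => .mul _ _)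
      (.bind (c' := N) (.tabulate fun i => runs_asPower _ d) fun o ho =>
        .bind_of (c' := 0) (.work N) (.pure ?_ _ _))) (fun _ h => h) ?_ subset_rfl
  · set v : Fin N → ℝ := fun i => row F i ⬝ᵥ w
    change ∀ i, (∀ b, o i = some b → v i = (b : ℝ)) ∧ ∀ b ≤ d, v i = (b : ℝ) → o i = some b at ho
    constructor
    · intro g hg
      split_ifs at hg with h
      obtain rfl := Option.some.inj hg
      refine ⟨(mem_colSpan_iff F _).2 ⟨w, fun i => ?_⟩, by simpa using h.2⟩
      obtain ⟨b, hb⟩ := Option.isSome_iff_exists.1 (h.1 i)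
      simpa [vec, hb] using (ho i).1 b hb
    · intro hspan g hg hgd hge
      obtain ⟨w₀, hw₀⟩ := (mem_colSpan_iff F _).1 hg
      have hsat : ∀ i ∈ I, row F i ⬝ᵥ w = (e i : ℝ) := by
        have := hw ⟨w₀, by
          simp only [List.mem_map, forall_exists_index, and_imp, forall_apply_eq_imp_iff₂]
          intro i hi
          rw [hw₀, vec, hge i hi]⟩
        simpa using this
      have hv : ∀ i, v i = (g i : ℝ) := fun i => by
        have := hspan (w - w₀) (fun i hi => by
          rw [dotProduct_sub, hsat i hi, hw₀, vec, hge i hi, sub_self]) i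
        rw [dotProduct_sub, hw₀, sub_eq_zero] at this
        exact this
      have ho' : ∀ i, o i = some (g i) := fun i =>
        (ho i).2 _ ((Finset.single_le_sum (fun _ _ => Nat.zero_le _)
          (Finset.mem_univ i)).trans hgd) (hv i)
      rw [if_pos ⟨fun i => by simp [ho'], by simpa [ho'] using hgd⟩]
      congr 1
      ext i
      simp [ho']
  · have : solveCost I.length F.length ≤ solveCost F.length F.length := by
      unfold solveCost orthogonalizeCost; gcongr
    simp only [liftCost, List.length_map] at this ⊢
    gcongr

theorem Blind.liftPowers (F : Rep N) (I : List (Fin N)) (e : Fin N →₀ ℕ) :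
    Blind (liftPowers d F I e : Prog N n _) := by
  refine .bind (.solve _) fun w => .bind (.of_computes fun _ => .tabulate fun _ =>
    .sumOver fun _ => .mul _ _) fun v => .bind (.tabulate fun i => ?_) fun o =>
    .bind (.unit _) fun _ => .pure _
  have : ∀ c, Blind (asPower (v i) c : Prog N n _) := fun c => by
    classical
    have hsame : ∀ a b : ℝ, Blind (same a b : Prog N n _) := fun a b =>
      .of_computes fun _ => .same a b
    induction c with
    | zero => exact .bind (hsame _ _) fun _ => .pure _
    | succ c ih =>
      refine .bind (hsame _ _) fun b => ?_
      split_ifs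
      · exact .pure _
      · exact ih
  exact this d

theorem eval_toPoly (L : List (Term N)) (x : Fin N → ℝ) :
    MvPolynomial.eval x (toPoly L) =
      ∑ m : Fin L.length, (L.get m).2 * ∏ i, x i ^ (L.get m).1 i := by
  rw [toPoly, map_list_sum, List.map_map, ← Fin.sum_univ_fun_getElem]
  refine Finset.sum_congr rfl fun m _ => ?_
  simp only [Function.comp_apply, MvPolynomial.eval_monomial]
  rw [Finsupp.prod_fintype _ _ fun i => pow_zero _]
  rfl

/-- A bound for the number of steps of `verify` for `l` terms. -/
def verifyCost {R : Type*} [CommSemiring R] (N d l : R) : R :=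
  N * l + (N * 2 + (l * (N * (d + 1) + 1 + 1) + (1 + 2)))

open Classical in
theorem runs_verify (L : List (Term N)) (hL : ∀ u ∈ L, ∀ i, u.1 i ≤ d) :
    Runs E (verify L) (· = decide (MvPolynomial.eval (E.data (Fin.last n)) (toPoly L) =
        MvPolynomial.eval (E.data (Fin.last n)) E.target))
      (verifyCost N d L.length) ({Fin.last n} ×ˢ relevantFeatures L) := by
  set y := E.data (Fin.last n)
  refine .bind_of (.work _) (.bind (.tabulate (c := 1)
    (Q := fun i v => v = if Relevant L i then y i else 0) fun i => ?_) fun x hx => .bind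
    (.sumOver (v := fun m => (L.get m).2 * ∏ i, x i ^ (L.get m).1 i) fun m => .bind (.prodOver fun i => (Runs.of_eq (.power _ _) _).mono (fun _ h => h)
        (hL _ (L.get_mem m) i) subset_rfl)
      fun p hp => .of (.mul _ _) (by rw [hp]) le_rfl _) fun v hv =>
    .bind (Q := fun z => z = MvPolynomial.eval y E.target) (c := 1) (c' := 2)
      (.of_eq (run_exec E (.label (Fin.last n))) _) fun z hz =>
      .of (.same _ _) ?_ le_rfl _)
  · split_ifs with h
    · have hr := run_exec E (.probe (Fin.last n) i)
      refine ⟨by rw [hr]; rfl, by rw [hr]; rfl, ?_⟩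
      rw [hr]
      simp [Instr.cells, relevantFeatures, h]
    · exact .pure_eq _ _ _
  · have : v = MvPolynomial.eval y (toPoly L) := by
      rw [hv, eval_toPoly]
      refine Finset.sum_congr rfl fun m _ => congrArg _ (Finset.prod_congr rfl fun i _ => ?_)
      rw [hx i]
      split_ifs with h
      · rfl
      · have h0 : (L.get m).1 i = 0 := by
          by_contra h0
          exact h ⟨_, L.get_mem m, h0⟩
        rw [h0, pow_zero, pow_zero]
    rw [this, hz]

theorem card_support_le_sum (g : Fin N →₀ ℕ) : g.support.card ≤ ∑ i, g i := by
  rw [Finset.card_eq_sum_ones]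
  calc ∑ i ∈ g.support, 1 ≤ ∑ i ∈ g.support, g i :=
        Finset.sum_le_sum fun i hi => Nat.one_le_iff_ne_zero.2 (Finsupp.mem_support_iff.1 hi)
    _ ≤ ∑ i, g i := Finset.sum_le_sum_of_subset (Finset.subset_univ _)

theorem sum_le_of_mem_support {G : MvPolynomial (Fin N) ℝ} (hG : G.totalDegree ≤ d)
    {g : Fin N →₀ ℕ} (hg : g ∈ G.support) : ∑ i, g i ≤ d := by
  have := (MvPolynomial.le_totalDegree hg).trans hG
  rwa [Finsupp.sum_fintype _ _ fun _ => rfl] at this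

theorem le_of_sum_le {g : Fin N →₀ ℕ} (hg : ∑ i, g i ≤ d) (i : Fin N) : g i ≤ d :=
  (Finset.single_le_sum (fun _ _ => Nat.zero_le _) (Finset.mem_univ i)).trans hg

end Lift

/-! ### One task: extraction, verification and learning from scratch. -/

section Task

variable {N n d : ℕ} {E : Env N n}

/-- The features that are selected as independent rows of the representation. -/
noncomputable def selected (E : Env N n) (F : Rep N) : List (Fin N) :=
  ((independentRows F [] (List.finRange N)).run E).value

/-- The result of the extraction with the representation, before the verification. -/
noncomputable def candidate (E : Env N n) (t : ℕ) (H : Inventory N d) (F : Rep N) :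
    Option (List (Term N)) :=
  ((extract H (selected E F) (liftPowers d F (selected E F)) t []).run E).value

/-- Every decision before the verification is made from oracle answers and arithmetic, so a single
verification example can be tested against a fixed candidate. -/
theorem candidate_congr_data (μ : Fin N → Measure ℝ) (G : MvPolynomial (Fin N) ℝ)
    (x y : Fin (n + 1) → Fin N → ℝ) (t : ℕ) (H : Inventory N d) (F : Rep N) :
    candidate ⟨μ, G, x⟩ t H F = candidate ⟨μ, G, y⟩ t H F := by
  have h : selected ⟨μ, G, x⟩ F = selected ⟨μ, G, y⟩ F := Blind.independentRows F [] _ μ G x y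
  rw [candidate, candidate, h]
  exact Blind.extract H _ (fun e => Blind.liftPowers F _ e) t [] μ G x y

theorem selected_spec (E : Env N n) (F : Rep N) :
    (selected E F).Nodup ∧ (selected E F).length ≤ F.length ∧
      ∀ v : Fin F.length → ℝ, (∀ i ∈ selected E F, row F i ⬝ᵥ v = 0) → ∀ i, row F i ⬝ᵥ v = 0 := by
  obtain ⟨h1, h2, h3⟩ := (runs_independentRows (E := E) F [] .nil (List.finRange N)).value
  exact ⟨h1.nodup (List.nodup_finRange N), by simpa [selected] using h2,
    fun v hv i => h3 v (by simp) hv i (List.mem_finRange i)⟩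

/-- Every term has passed through `liftPowers`, whatever the target is. This limits the features
needed for the verification and shows that an accepted target is covered. -/
theorem mem_colSpan_of_candidate {t : ℕ} {H : Inventory N d}
    (hH : ∀ i a, a ≠ 0 → H i 0 a = 0) {F : Rep N} {L : List (Term N)}
    (hL : candidate E t H F = some L) :
    L.length ≤ t ∧ ∀ u ∈ L, vec u.1 ∈ colSpan F ∧ ∑ i, u.1 i ≤ d := by
  obtain ⟨-, h2, -⟩ := selected_spec E F
  obtain ⟨B, -, hB⟩ := runs_extract (E := E) hH (selected E F) (D := d)
    (fun e => (runs_liftPowers (d := d) F _ h2 e).mono (fun o ho => ho.1) le_rfl subset_rfl)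
    (fun g hg => (card_support_le_sum g).trans hg.2) t [] le_rfl
  simpa using hB.value L hL

theorem candidate_of_mem_colSpan (hE : E.IsRegular d) {t : ℕ} {H : Inventory N d}
    (hH : ∀ i, IsOrthonormalInventory (E.dist i) (H i)) {F : Rep N} (hF : ∃ f ∈ F, f ≠ 0)
    (hdeg : E.target.totalDegree ≤ d) (hcard : E.target.support.card ≤ t)
    (hcol : ∀ g ∈ E.target.support, vec g ∈ colSpan F) :
    ∃ L, candidate E t H F = some L ∧ IsTermList L E.target := by
  obtain ⟨h1, h2, h3⟩ := selected_spec E F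
  refine extract_value hE hH (fun g hg => le_of_sum_le (sum_le_of_mem_support hdeg hg)) h1 ?_ ?_
    (.nil _) (by simpa using hcard)
  -- If no row were selected, the matrix would annihilate every vector, against its nonzero column.
  -- A nonempty list is needed for the search to notice that the target is exhausted.
  · intro h0
    obtain ⟨f, hf, hf0⟩ := hF
    obtain ⟨i, hi⟩ := Finsupp.ne_iff.1 hf0
    obtain ⟨l, rfl⟩ := List.get_of_mem hf
    have := h3 (Pi.single l 1) (by simp [h0]) i
    rw [dotProduct_single, mul_one] at this
    exact hi (by simpa [row] using this)
  · intro e _ g hg hge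
    exact (runs_liftPowers (d := d) F _ h2 e).value.2 h3 g (hcol g hg)
      (sum_le_of_mem_support hdeg hg) hge

open Classical in
theorem useRep_value {t : ℕ} {H : Inventory N d} (hH : ∀ i a, a ≠ 0 → H i 0 a = 0) {F : Rep N}
    (hF : F ≠ []) :
    ((useRep t H F).run E).value = (candidate E t H F).bind fun L =>
      if MvPolynomial.eval (E.data (Fin.last n)) (toPoly L) =
        MvPolynomial.eval (E.data (Fin.last n)) E.target then some L else none := by
  rw [useRep, run_bind_value, if_neg (by simpa using hF), run_bind_value, run_bind_value,
    run_bind_value]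
  change ((match candidate E t H F with
    | none => _
    | some L => _ : Prog N n _).run E).value = _
  rcases hc : candidate E t H F with - | L
  · rfl
  · simp only [Option.bind_some]
    rw [run_bind_value, (runs_verify L fun u hu =>
      le_of_sum_le ((mem_colSpan_of_candidate hH hc).2 u hu).2).value, run_pure]
    simp

/-- A bound for the number of steps of `useRep` with `n` examples, `t` terms and `f` columns. -/
def useRepCost {R : Type*} [CommSemiring R] (N n d t f : R) : R :=
  1 + (orthogonalizeCost f N f + (n * f + (extractCost N d t f (liftCost N d f) t +
    verifyCost N d t)))

/-- On each training example: one feature for each selected row and at most `d` for each of at most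
`t` terms. The last `t * d` is for the verification example. -/
theorem runs_useRep {H : Inventory N d} (hH : ∀ i a, a ≠ 0 → H i 0 a = 0) (t : ℕ) (F : Rep N) :
    ∃ A : Finset (Fin (n + 1) × Fin N), A.card ≤ n * (F.length + t * d) + t * d ∧
      Runs E (useRep t H F) (fun _ => True) (useRepCost N n d t F.length) A := by
  classical
  by_cases hF : F = []
  · subst hF
    exact ⟨∅, by simp, Runs.mono (.bind_of (.work 1) (.pure trivial 0 _)) (fun _ h => h)
      (by unfold useRepCost; omega) subset_rfl⟩
  obtain ⟨-, h2, -⟩ := selected_spec E F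
  obtain ⟨B, hBc, hB⟩ := runs_extract (E := E) hH (selected E F) (D := d)
    (fun e => (runs_liftPowers (d := d) F _ h2 e).mono (fun o ho => ho.1) le_rfl subset_rfl)
    (fun g hg => (card_support_le_sum g).trans hg.2) (l := t) t [] (by simp)
  have hr0 : relevantFeatures ([] : List (Term N)) = ∅ := by
    simp [relevantFeatures, Relevant]
  rw [hr0, Finset.union_empty] at hB
  set R := relevantFeatures ((candidate E t H F).getD [])
  have hR : R.card ≤ t * d := by
    rcases hc : candidate E t H F with - | L
    · simp [R, hc, hr0]
    · obtain ⟨h3, h4⟩ := mem_colSpan_of_candidate hH hc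
      refine (card_relevantFeatures_le _ d ?_).trans (Nat.mul_le_mul_right _ ?_)
      · simpa [hc] using fun u a hu => (card_support_le_sum u).trans (h4 _ hu).2
      · simpa [hc] using h3
  refine ⟨trainingCells n ((selected E F).toFinset ∪ B) ∪ {Fin.last n} ×ˢ R, ?_, ?_⟩
  · refine (Finset.card_union_le _ _).trans (add_le_add ?_ (by simpa using hR))
    rw [card_trainingCells]
    gcongr
    refine (Finset.card_union_le _ _).trans (add_le_add ?_ hBc)
    exact (List.toFinset_card_le _).trans h2
  · refine Runs.mono (.bind_of (c' := orthogonalizeCost F.length N F.length + (n * F.length +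
      (extractCost N d t F.length (liftCost N d F.length) t + verifyCost N d t))) (.work 1) ?_)
      (fun _ h => h) le_rfl subset_rfl
    rw [if_neg (by simpa using hF)]
    refine .bind_value (((runs_independentRows F [] .nil _).mono (Q' := fun _ => True)
      (fun _ _ => trivial) ?_ (Finset.empty_subset _))) ?_
    · simp
    change Runs E (probeTraining (selected E F) >>= _) _ _ _
    refine .bind_value ((runs_probeTraining _).mono (fun _ h => h) ?_
      (Finset.Subset.trans (trainingCells_mono Finset.subset_union_left)
        Finset.subset_union_left)) ?_
    · gcongr
    refine .bind_value (hB.mono (fun _ h => h) ?_ Finset.subset_union_left) ?_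
    · unfold extractCost; gcongr
    change Runs E (match candidate E t H F with
      | none => _
      | some L => _ : Prog N n _) _ _ _
    rcases hc : candidate E t H F with - | L
    · exact .pure trivial _ _
    · obtain ⟨h3, h4⟩ := mem_colSpan_of_candidate hH hc
      refine Runs.mono (.bind (c' := 0) (runs_verify L fun u hu => le_of_sum_le (h4 u hu).2)
        fun b _ => .pure trivial _ _) (fun _ h => h) ?_ ?_
      · simp only [verifyCost, add_zero]; gcongr
      · simp [R, hc]

/-- A bound for the number of steps of `learnFromScratch`. -/
def learnFromScratchCost {R : Type*} [CommSemiring R] (N n d t : R) : R :=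
  n * N + extractCost N d t N 0 t

/-- Powers on all features are the monomial itself, so the identity serves as `lift`, at no cost. -/
theorem runs_learnFromScratch (hE : E.IsRegular d) {t : ℕ} {H : Inventory N d}
    (hH : ∀ i, IsOrthonormalInventory (E.dist i) (H i)) (hN : 0 < N)
    (hdeg : E.target.totalDegree ≤ d) (hcard : E.target.support.card ≤ t) :
    Runs E (learnFromScratch t H) (fun L => IsTermList L E.target ∧ L.length ≤ t)
      (learnFromScratchCost N n d t) (trainingCells n Finset.univ) := by
  have hH' : ∀ i a, a ≠ 0 → H i 0 a = 0 := fun i a ha =>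
    (hH i).apply_eq_zero 0 a (Fin.pos_iff_ne_zero.2 ha)
  obtain ⟨B, -, hB⟩ := runs_extract (E := E) hH' (List.finRange N)
    (lift := fun e => pure (some e)) (P := fun _ => True) (D := N) (c := 0)
    (fun e => .pure (fun _ _ => trivial) _ _)
    (fun g _ => (Finset.card_le_univ _).trans (by simp)) (l := t) t [] (by simp)
  obtain ⟨L, h1, h2⟩ := extract_value hE hH
    (fun g hg => le_of_sum_le (sum_le_of_mem_support hdeg hg)) (List.nodup_finRange N)
    (by simpa using hN.ne') (lift := fun e => pure (some e)) (fun e _ g _ hge => by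
      rw [run_pure]
      exact congrArg some (Finsupp.ext fun i => (hge i (List.mem_finRange i)).symm)) (r := t)
    (.nil _) (by simpa using hcard)
  refine Runs.mono (.bind (c' := extractCost N d t N 0 t + 0) ((runs_probeTraining _).mono
    (fun _ h => h) le_rfl (trainingCells_mono (Finset.subset_univ _))) fun _ _ =>
    .bind_value (c := extractCost N d t N 0 t) (c' := 0) (hB.mono (fun _ h => h) (by rw [List.length_finRange])
      (trainingCells_mono (Finset.subset_univ _))) ?_) (fun _ h => h) ?_ subset_rfl
  · rw [h1]
    exact .pure ⟨h2, by simpa using (hB.value L h1).1⟩ _ _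
  · simp [learnFromScratchCost]

/-- A bound for the number of steps of the protocol on one task, with `n` training examples and a
representation with `f` columns. -/
def taskCost {R : Type*} [CommSemiring R] (N n d t f : R) : R :=
  inventoryCost N d + (useRepCost N n d t f + (learnFromScratchCost N n d t +
    t * inColumnSpaceCost N (f + t)))

/-- The verification on the last example is sound for the result of the extraction with `F`. -/
def VerificationSound (E : Env N n) (d t : ℕ) (F : Rep N) : Prop :=
  ∀ L, candidate E t ((inventory d).run E).value F = some L →
    MvPolynomial.eval (E.data (Fin.last n)) (toPoly L) =
      MvPolynomial.eval (E.data (Fin.last n)) E.target → toPoly L = E.target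

/-- The columns of a representation are different and linearly independent. -/
def IsIndependent (F : Rep N) : Prop := F.Nodup ∧ LinearIndepOn ℝ vec {f | f ∈ F}

theorem IsIndependent.exists_ne_zero {F : Rep N} (hF : IsIndependent F) (hne : F ≠ []) :
    ∃ f ∈ F, f ≠ 0 := by
  obtain ⟨f, hf⟩ := List.exists_mem_of_ne_nil F hne
  refine ⟨f, hf, fun h0 => hF.2.ne_zero hf ?_⟩
  ext i
  simp [h0, vec]

/-- The properties of the run of the protocol on one task. -/
structure TaskOutcome (G : MvPolynomial (Fin N) ℝ) (d t : ℕ) (F : Rep N)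
    (r : Outcome N n (TaskResult N)) : Prop where
  output : IsTermList r.value.output G
  rep_eq : r.value.fromScratch = false → r.value.rep = F
  rep_ne_nil : r.value.rep ≠ []
  length_lt : r.value.fromScratch = true → F.length < r.value.rep.length
  independent : IsIndependent r.value.rep
  mem_rep : ∀ f ∈ r.value.rep, f ∈ F ∨ f ∈ G.support
  steps : r.steps ≤ taskCost N n d t F.length
  cells : r.cells.card ≤ n * (F.length + t * d) + t * d +
    if r.value.fromScratch = true then n * N else 0

theorem taskProgram_outcome (hE : E.IsRegular d) {t : ℕ} (hdeg : E.target.totalDegree ≤ d)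
    (hcard : E.target.support.card ≤ t) {F : Rep N} (hF : IsIndependent F)
    (hF0 : F = [] → ∃ g ∈ E.target.support, g ≠ 0) (hver : VerificationSound E d t F) :
    TaskOutcome E.target d t F ((taskProgram d t F).run E) := by
  classical
  have := hE.prob
  have := hE.atomless
  have hinv := runs_inventory hE.integrable
  set H := ((inventory d).run E).value with hHdef
  have hH : ∀ i, IsOrthonormalInventory (E.dist i) (H i) := hinv.value
  have hH' : ∀ i a, a ≠ 0 → H i 0 a = 0 := fun i a ha =>
    (hH i).apply_eq_zero 0 a (Fin.pos_iff_ne_zero.2 ha)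
  -- A nonzero exponent vector exists, either in the target or among the independent columns.
  have hN : 0 < N := by
    obtain ⟨g, hg⟩ : ∃ g : Fin N →₀ ℕ, g ≠ 0 := by
      by_cases h : F = []
      · exact (hF0 h).imp fun g hg => hg.2
      · exact (hF.exists_ne_zero h).imp fun g hg => hg.2
    obtain ⟨i, -⟩ := Finsupp.ne_iff.1 hg
    exact i.pos
  obtain ⟨A, hA, huse⟩ := runs_useRep (E := E) hH' t F
  rcases ho : ((useRep t H F).run E).value with - | L
  · have hscr := runs_learnFromScratch hE hH hN hdeg hcard
    set L := ((learnFromScratch t H).run E).value with hLdef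
    obtain ⟨hL, hLt⟩ := hscr.value
    have hsupp : ∀ g, g ∈ E.target.support ↔ ∃ u ∈ L, u.1 = g := fun g => by
      rw [MvPolynomial.mem_support_iff]
      constructor
      · exact fun h => ⟨_, (hL.2 g _).2 ⟨h, rfl⟩, rfl⟩
      · rintro ⟨u, hu, rfl⟩
        obtain ⟨h1, h2⟩ := (hL.2 u.1 u.2).1 hu
        rwa [h2]
    -- A nonempty representation that covers the target would have extracted it and passed the
    -- verification. The empty one has the zero column space, which misses a nonconstant monomial.
    have hnew : ∃ u ∈ L, vec u.1 ∉ colSpan F := by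
      by_contra! hcon
      have hcol : ∀ g ∈ E.target.support, vec g ∈ colSpan F := fun g hg => by
        obtain ⟨u, hu, rfl⟩ := (hsupp g).1 hg
        exact hcon u hu
      by_cases h : F = []
      · obtain ⟨g, hg, hg0⟩ := hF0 h
        have := hcol g hg
        rw [h, colSpan] at this
        obtain ⟨i, hi⟩ := Finsupp.ne_iff.1 hg0
        have := congrFun (by simpa using this : vec g = 0) i
        exact hi (by simpa [vec] using this)
      · obtain ⟨L', h1, h2⟩ := candidate_of_mem_colSpan hE hH (hF.exists_ne_zero h) hdeg hcard hcol
        rw [useRep_value hH' h, h1, Option.bind_some, if_pos (by rw [h2.toPoly_eq])] at ho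
        cases ho
    have himp := runs_improveRep (E := E) L F (F.length + t) (by gcongr)
    have hrun : Runs E (taskProgram d t F) (fun r => r = ⟨L, true,
        ((improveRep L F).run E).value⟩) (taskCost N n d t F.length)
        (A ∪ trainingCells n Finset.univ) := by
      refine .bind_value (hinv.mono (fun _ h => h) le_rfl (Finset.empty_subset _)) ?_
      rw [← hHdef]
      refine .bind_value (huse.mono (fun _ h => h) le_rfl Finset.subset_union_left) ?_
      rw [ho]
      refine .bind_value (hscr.mono (fun _ h => h) le_rfl Finset.subset_union_right) ?_
      rw [← hLdef]
      refine Runs.mono (.bind_value (c' := 0) (himp.mono (fun _ h => h) le_rfl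
        (Finset.empty_subset _)) (.pure_eq _ _ _)) (fun _ h => h) ?_ subset_rfl
      have := Nat.mul_le_mul_right (inColumnSpaceCost N (F.length + t)) hLt
      simpa using this
    obtain ⟨h1, h2, h3, h4⟩ := himp.value
    have hv := hrun.value
    have h4 := h4 hnew
    refine ⟨by rw [hv]; exact hL, by rw [hv]; simp,
      by rw [hv]; exact List.ne_nil_of_length_pos (Nat.zero_lt_of_lt h4), by rw [hv]; exact fun _ => h4,
      by rw [hv]; exact h3 hF, ?_, hrun.steps, ?_⟩
    · rw [hv]
      exact fun f hf => (h2 f hf).imp_right (hsupp f).2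
    · rw [hv, if_pos rfl]
      refine (Finset.card_le_card hrun.cells).trans ((Finset.card_union_le _ _).trans
        (add_le_add hA ?_))
      rw [card_trainingCells]
      simp
  · have hne : F ≠ [] := by
      rintro rfl
      have : ((useRep t H []).run E).value = none := by
        rw [useRep, run_bind_value]
        rfl
      rw [this] at ho
      cases ho
    rw [useRep_value hH' hne, Option.bind_eq_some_iff] at ho
    obtain ⟨L₀, hc, hif⟩ := ho
    split_ifs at hif with hev
    obtain rfl := Option.some.inj hif
    have hpoly := hver L₀ hc hev
    -- Equality of polynomials does not exclude repeated monomials or zero coefficients in `L₀`. It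
    -- does show that the target is covered, and then `candidate_of_mem_colSpan` describes the same
    -- list exactly.
    have hcol : ∀ g ∈ E.target.support, vec g ∈ colSpan F := fun g hg => by
      rw [← hpoly, MvPolynomial.mem_support_iff] at hg
      by_contra hcon
      refine hg (coeff_toPoly_eq_zero fun u hu he => hcon ?_)
      rw [← he]
      exact ((mem_colSpan_of_candidate hH' hc).2 u hu).1
    obtain ⟨L', h1, h2⟩ := candidate_of_mem_colSpan hE hH (hF.exists_ne_zero hne) hdeg hcard hcol
    obtain rfl : L₀ = L' := Option.some.inj (hc.symm.trans h1)
    have hval : ((useRep t H F).run E).value = some L₀ := by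
      rw [useRep_value hH' hne, hc, Option.bind_some, if_pos hev]
    have hrun : Runs E (taskProgram d t F) (fun r => r = ⟨L₀, false, F⟩)
        (taskCost N n d t F.length) A := by
      refine .bind_value (hinv.mono (fun _ h => h) le_rfl (Finset.empty_subset _)) ?_
      rw [← hHdef]
      refine .bind_value huse ?_
      rw [hval]
      exact .pure_eq _ _ _
    have hv := hrun.value
    refine ⟨by rw [hv]; exact h2, by rw [hv]; simp, by rw [hv]; exact hne, by rw [hv]; simp,
      by rw [hv]; exact hF,
      by rw [hv]; exact fun f hf => .inl hf, hrun.steps, ?_⟩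
    rw [hv]
    exact (Finset.card_le_card hrun.cells).trans (by simpa using hA)

end Task

/-! ### The lifelong protocol -/

section Lifelong

variable {N : ℕ}

/-- The candidate is the same for all data, so its difference from `G` is one fixed polynomial; if
nonzero, its zero set is null for the law of the verification example. -/
theorem ae_verificationSound {n : ℕ} {μ : Fin N → Measure ℝ} [∀ i, IsProbabilityMeasure (μ i)]
    [∀ i, NullSingletonClass (μ i)] (G : MvPolynomial (Fin N) ℝ) (d t : ℕ) (F : Rep N)
    {Ω : Type*} [MeasurableSpace Ω] {P : Measure Ω} {X : Fin (n + 1) → Ω → Fin N → ℝ}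
    (hX : HasLaw (X (Fin.last n)) (Measure.pi μ) P) :
    ∀ᵐ ω ∂P, VerificationSound ⟨μ, G, fun s => X s ω⟩ d t F := by
  have hcand : ∀ x, candidate ⟨μ, G, x⟩ t ((inventory d).run (⟨μ, G, x⟩ : Env N n)).value F =
      candidate ⟨μ, G, 0⟩ t ((inventory d).run (⟨μ, G, 0⟩ : Env N n)).value F := fun x => by
    rw [Blind.inventory μ G x 0]
    exact candidate_congr_data μ G x 0 t _ F
  simp only [VerificationSound, hcand]
  rcases candidate ⟨μ, G, 0⟩ t ((inventory d).run (⟨μ, G, 0⟩ : Env N n)).value F with - | L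
  · simp
  by_cases hL : toPoly L = G
  · refine .of_forall fun ω L' h _ => ?_
    cases h
    exact hL
  · have h := ae_mvPolynomial_eval_ne_zero μ (sub_ne_zero.2 hL)
    rw [← hX.map_eq] at h
    filter_upwards [ae_of_ae_map hX.aemeasurable h] with ω hω L' hL' hev
    cases hL'
    rw [map_sub, sub_ne_zero] at hω
    exact absurd hev hω

theorem IsIndependent.length_le {R : Rep N} (hR : IsIndependent R) {K : ℕ}
    (F : Matrix (Fin N) (Fin K) ℝ) (hF : ∀ f ∈ R, vec f ∈ LinearMap.range F.mulVecLin) :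
    R.length ≤ K := by
  classical
  have hli : LinearIndependent ℝ fun f : {f // f ∈ R.toFinset} =>
      (⟨vec f.1, hF f.1 (List.mem_toFinset.1 f.2)⟩ : LinearMap.range F.mulVecLin) := by
    refine LinearIndependent.of_comp (LinearMap.range F.mulVecLin).subtype ?_
    have h2 := hR.2
    have : {f | f ∈ R} = (R.toFinset : Set (Fin N →₀ ℕ)) := by ext; simp
    rw [this] at h2
    exact h2
  have h1 := hli.fintype_card_le_finrank
  rw [Fintype.card_coe, List.toFinset_card_of_nodup hR.1] at h1
  exact h1.trans ((LinearMap.finrank_range_le _).trans (by simp))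

theorem taskCost_mono (N d t : ℕ) {n n' f f' : ℕ} (hn : n ≤ n') (hf : f ≤ f') :
    taskCost N n d t f ≤ taskCost N n' d t f' := by
  unfold taskCost useRepCost learnFromScratchCost inColumnSpaceCost extractCost liftCost solveCost
    orthogonalizeCost
  gcongr

/-- The polynomial in `m, N, K, S, t, d` that bounds the number of steps. -/
noncomputable def stepPolynomial : MvPolynomial (Fin 6) ℕ :=
  MvPolynomial.X 0 * taskCost (MvPolynomial.X 1) (MvPolynomial.X 3) (MvPolynomial.X 5)
    (MvPolynomial.X 4) (MvPolynomial.X 2)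

/-- The cost expressions live in any commutative semiring, so the formula proved for numbers, read
at the variables, is itself the polynomial, and evaluation commutes with it. -/
theorem eval_stepPolynomial (m N K S t d : ℕ) :
    MvPolynomial.eval ![m, N, K, S, t, d] stepPolynomial = m * taskCost N S d t K := by
  simp [stepPolynomial, taskCost, useRepCost, learnFromScratchCost, inColumnSpaceCost, extractCost,
    liftCost, solveCost, orthogonalizeCost, inventoryCost, gramSchmidtCost, testCost,
    coefficientCost, verifyCost]

/-! ### Accounting over the sequence of tasks. -/

section Protocol

variable {m K S d t : ℕ} {task : Fin m → Task N}
  {x : (j : Fin m) → Fin ((task j).size + 1) → Fin N → ℝ}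

theorem repAfter_succ (j : Fin m) :
    repAfter d t task x (j + 1) = (protocol d t task x j).value.rep := by
  rw [repAfter, dif_pos j.2]
  rfl

open Classical in
/-- The tasks before `j` that are learned from scratch. -/
noncomputable def scratchBefore (d t : ℕ) (task : Fin m → Task N)
    (x : (j : Fin m) → Fin ((task j).size + 1) → Fin N → ℝ) (j : ℕ) : Finset (Fin m) :=
  Finset.univ.filter fun i => i < j ∧ (protocol d t task x i).value.fromScratch = true

/-- The properties of the representation after `j` tasks. -/
structure IsGoodRep (F : Matrix (Fin N) (Fin K) ℝ) (d t : ℕ) (task : Fin m → Task N)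
    (x : (j : Fin m) → Fin ((task j).size + 1) → Fin N → ℝ) (j : ℕ) : Prop where
  independent : IsIndependent (repAfter d t task x j)
  mem_range : ∀ f ∈ repAfter d t task x j, vec f ∈ LinearMap.range F.mulVecLin
  ne_nil : 0 < j → repAfter d t task x j ≠ []
  card_le : (scratchBefore d t task x j).card ≤ (repAfter d t task x j).length

theorem IsGoodRep.outcome {F : Matrix (Fin N) (Fin K) ℝ} {j : Fin m}
    (h : IsGoodRep F d t task x j)
    (hreg : (⟨(task j).dist, (task j).target, x j⟩ : Env N (task j).size).IsRegular d)
    (hdeg : (task j).target.totalDegree ≤ d) (hcard : (task j).target.support.card ≤ t)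
    (hfirst : (j : ℕ) = 0 → ∃ g ∈ (task j).target.support, g ≠ 0)
    (hver : ∀ R, VerificationSound ⟨(task j).dist, (task j).target, x j⟩ d t R) :
    TaskOutcome (task j).target d t (repAfter d t task x j) (protocol d t task x j) :=
  taskProgram_outcome hreg hdeg hcard h.independent (fun h0 => hfirst (by
    by_contra hj
    exact h.ne_nil (Nat.pos_of_ne_zero hj) h0)) (hver _)

/-- Each task learned from scratch is charged to a column that it adds. -/
theorem IsGoodRep.succ {F : Matrix (Fin N) (Fin K) ℝ} {j : Fin m}
    (h : IsGoodRep F d t task x j)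
    (ho : TaskOutcome (task j).target d t (repAfter d t task x j) (protocol d t task x j))
    (hcol : ∀ g ∈ (task j).target.support, vec g ∈ LinearMap.range F.mulVecLin) :
    IsGoodRep F d t task x (j + 1) := by
  classical
  have hsucc := repAfter_succ (d := d) (t := t) (x := x) j
  refine ⟨hsucc ▸ ho.independent, fun f hf => ?_, fun _ => hsucc ▸ ho.rep_ne_nil, ?_⟩
  · rw [hsucc] at hf
    exact (ho.mem_rep f hf).elim (h.mem_range f) (hcol f)
  · rw [hsucc]
    by_cases hs : (protocol d t task x j).value.fromScratch = true
    · have hsub : scratchBefore d t task x (j + 1) ⊆ insert j (scratchBefore d t task x j) := by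
        intro i hi
        simp only [scratchBefore, Finset.mem_filter, Finset.mem_univ, true_and,
          Finset.mem_insert] at hi ⊢
        rcases Nat.lt_succ_iff_lt_or_eq.1 hi.1 with h | h
        · exact .inr ⟨h, hi.2⟩
        · exact .inl (Fin.ext h)
      have h1 := (Finset.card_le_card hsub).trans (Finset.card_insert_le _ _)
      have h2 := ho.length_lt hs
      have h3 := h.card_le
      omega
    · rw [ho.rep_eq (by simpa using hs)]
      refine (Finset.card_le_card fun i hi => ?_).trans h.card_le
      simp only [scratchBefore, Finset.mem_filter, Finset.mem_univ, true_and] at hi ⊢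
      rcases Nat.lt_succ_iff_lt_or_eq.1 hi.1 with h | h
      · exact ⟨h, hi.2⟩
      · exact absurd (Fin.ext h ▸ hi.2) hs

/-- The deterministic core: chance enters only through `hver`. -/
theorem protocol_bounds (F : Matrix (Fin N) (Fin K) ℝ) (hS : 0 < S)
    (hsize : ∀ j, (task j).size ≤ S)
    (hreg : ∀ j, (⟨(task j).dist, (task j).target, x j⟩ : Env N (task j).size).IsRegular d)
    (hdeg : ∀ j, (task j).target.totalDegree ≤ d) (hcard : ∀ j, (task j).target.support.card ≤ t)
    (hcol : ∀ j, ∀ g ∈ (task j).target.support, vec g ∈ LinearMap.range F.mulVecLin)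
    (hfirst : ∀ j : Fin m, (j : ℕ) = 0 → ∃ g ∈ (task j).target.support, g ≠ 0)
    (hver : ∀ j R, VerificationSound ⟨(task j).dist, (task j).target, x j⟩ d t R) :
    (∀ j, IsTermList (protocol d t task x j).value.output (task j).target) ∧
      scratchCount d t task x ≤ K ∧
      featureEvaluations d t task x ≤ 2 * (S * (K * N + m * (K + d * t))) ∧
      totalSteps d t task x ≤ m * taskCost N S d t K := by
  classical
  have hgood : ∀ j, j ≤ m → IsGoodRep F d t task x j := by
    intro j
    induction j with
    | zero =>
      refine fun _ => ⟨⟨by simp [repAfter], ?_⟩, by simp [repAfter], by simp, by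
        simp [scratchBefore]⟩
      simp [repAfter]
    | succ j ih =>
      intro hj
      have h := ih (by omega)
      exact h.succ (j := ⟨j, hj⟩) (h.outcome (j := ⟨j, hj⟩) (hreg _) (hdeg _) (hcard _) (hfirst _)
        (hver _)) (hcol _)
  have hout : ∀ j : Fin m, TaskOutcome (task j).target d t (repAfter d t task x j)
      (protocol d t task x j) := fun j =>
    (hgood j j.2.le).outcome (hreg j) (hdeg j) (hcard j) (hfirst j) (hver j)
  have hlen : ∀ j, j ≤ m → (repAfter d t task x j).length ≤ K := fun j hj =>
    (hgood j hj).independent.length_le F (hgood j hj).mem_range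
  have hscratch : scratchCount d t task x ≤ K := by
    refine le_trans ?_ ((hgood m le_rfl).card_le.trans (hlen m le_rfl))
    refine Finset.card_le_card fun i hi => ?_
    simpa [scratchBefore] using hi
  refine ⟨fun j => (hout j).output, hscratch, ?_, ?_⟩
  · have hj : ∀ j : Fin m, (protocol d t task x j).cells.card ≤ (S * (K + t * d) + t * d) +
        if (protocol d t task x j).value.fromScratch = true then S * N else 0 := fun j => by
      refine (hout j).cells.trans ?_
      have h1 := hsize j
      have h2 := hlen j j.2.le
      split_ifs <;> gcongr
    -- The verification example is absorbed into the training examples, which doubles the `t * d`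
    -- term and leads to the constant `2`; the other terms are padded below to match.
    have htd : t * d ≤ S * (t * d) := Nat.le_mul_of_pos_left _ hS
    calc featureEvaluations d t task x
        ≤ ∑ j : Fin m, ((S * (K + t * d) + t * d) +
          if (protocol d t task x j).value.fromScratch = true then S * N else 0) :=
          Finset.sum_le_sum fun j _ => hj j
      _ = m * (S * (K + t * d) + t * d) + scratchCount d t task x * (S * N) := by
          rw [Finset.sum_add_distrib, ← Finset.sum_filter]
          simp [scratchCount]
      _ ≤ m * (S * (K + t * d) + S * (t * d)) + K * (S * N) := by gcongr
      _ ≤ m * (S * (K + t * d) + S * (t * d)) + K * (S * N) + (m * (S * K) + K * (S * N)) :=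
          Nat.le_add_right _ _
      _ = 2 * (S * (K * N + m * (K + d * t))) := by ring
  · calc totalSteps d t task x ≤ ∑ _j : Fin m, taskCost N S d t K :=
          Finset.sum_le_sum fun j _ =>
            (hout j).steps.trans (taskCost_mono N d t (hsize j) (hlen j j.2.le))
      _ = m * taskCost N S d t K := by simp

end Protocol

end Lifelong

end LifelongPoly

/-! ### The theorem. -/

theorem theorem5 :
    ∃ (C : ℕ) (T : MvPolynomial (Fin 6) ℕ),
      ∀ (m N K S d t : ℕ) (F : Matrix (Fin N) (Fin K) ℝ) (task : Fin m → LifelongPoly.Task N)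
        (Ω : Type*) (_ : MeasurableSpace Ω) (P : Measure Ω)
        (X : (j : Fin m) → Fin ((task j).size + 1) → Ω → Fin N → ℝ),
        IsProbabilityMeasure P →
        0 < S →
        (∀ j, (task j).size ≤ S) →
        -- known product distributions: the marginals are atomless and have the moments that the
        -- correlations involve
        (∀ j i, IsProbabilityMeasure ((task j).dist i)) →
        (∀ j i (y : ℝ), (task j).dist i {y} = 0) →
        (∀ j i, Integrable (fun y : ℝ => y ^ (4 * d)) ((task j).dist i)) →
        -- the targets have degree at most `d` and at most `t` monomials, all in the column space
        (∀ j, (task j).target.totalDegree ≤ d) →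
        (∀ j, (task j).target.support.card ≤ t) →
        (∀ j, ∀ g ∈ (task j).target.support,
          LifelongPoly.vec g ∈ LinearMap.range F.mulVecLin) →
        -- the first target is not a constant
        (∀ j : Fin m, (j : ℕ) = 0 → ∃ g ∈ (task j).target.support, g ≠ 0) →
        -- the examples of every task are drawn i.i.d. from its distribution
        (∀ j s, HasLaw (X j s) (Measure.pi (task j).dist) P) →
        (∀ j, iIndepFun (X j) P) →
        ∀ᵐ ω ∂P,
          (∀ j, LifelongPoly.IsTermList
            (LifelongPoly.protocol d t task (fun j s => X j s ω) j).value.output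
            (task j).target) ∧
          LifelongPoly.scratchCount d t task (fun j s => X j s ω) ≤ K ∧
          LifelongPoly.featureEvaluations d t task (fun j s => X j s ω) ≤
            C * (S * (K * N + m * (K + d * t))) ∧
          LifelongPoly.totalSteps d t task (fun j s => X j s ω) ≤
            MvPolynomial.eval ![m, N, K, S, t, d] T := by
  refine ⟨2, LifelongPoly.stepPolynomial, ?_⟩
  intro m N K S d t F task Ω _ P X _ hS hsize hprob hatom hint hdeg hcard hcol hfirst hlaw _
  have hatom' : ∀ j i, NullSingletonClass ((task j).dist i) := fun j i => ⟨hatom j i⟩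
  have hver : ∀ᵐ ω ∂P, ∀ j R, LifelongPoly.VerificationSound
      ⟨(task j).dist, (task j).target, fun s => X j s ω⟩ d t R := by
    rw [ae_all_iff]
    intro j
    -- Representations are lists of exponent vectors, hence countably many. Quantifying over all of
    -- them makes it irrelevant that the one in use depends on the examples of earlier tasks.
    rw [ae_all_iff]
    intro R
    exact LifelongPoly.ae_verificationSound (task j).target d t R (hlaw j _)
  filter_upwards [hver] with ω hω
  rw [LifelongPoly.eval_stepPolynomial]
  exact LifelongPoly.protocol_bounds F hS hsize (fun j => ⟨hprob j, hatom' j, hint j⟩) hdeg hcard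
    hcol hfirst hω
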